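/- Let $M^n\subset S^{n+1}\subset\mathbb{R}^{n+2}$ be a minimal isoparametric hypersurface with four distinct principal curvatures: $M$ is a smooth embedded hypersurface with a smooth unit normal field $\nu$ in $S^{n+1}$, its principal curvatures with respect to $\nu$ are four distinct constants with constant multiplicities, and its mean curvature in $S^{n+1}$ vanishes. Let $m_1\leq m_2$ be the smallest and the largest of the four multiplicities (these are the only values that occur). Let $M_+$ be a focal manifold of $M$ of codimension $1+m_1$ in $S^{n+1}$, that is, one of the sets $\{\cos(t)\,p+\sin(t)\,\nu(p) : p\in M\}$, $t\in\mathbb{R}$, that is a smooth embedded submanifold of $S^{n+1}$ of dimension $n-m_1<n$. If $$m_2>\frac{3m_1+10}{4},$$ then $M_+$, with the Riemannian metric induced from $\mathbb{R}^{n+2}$, has positive Ricci curvature: $\operatorname{Ric}(X,X)>0$ for every nonzero tangent vector $X$ of $M_+$. -/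

import Mathlib

open scoped ContDiff

noncomputable section

namespace FocalRicci

/-- Euclidean space `ℝ^N` with its Euclidean norm. -/
abbrev E (N : ℕ) : Type := EuclideanSpace ℝ (Fin N)

/-- The partial derivative `∂f/∂x_i` at `x` of a map defined on (an open subset of) `ℝ^k`. -/
def partialDeriv {k : ℕ} {F : Type*} [NormedAddCommGroup F] [NormedSpace ℝ F]
    (f : E k → F) (i : Fin k) (x : E k) : F :=
  fderiv ℝ f x (EuclideanSpace.single i 1)

/-! ### Embedded submanifolds of Euclidean space -/

/-- `φ : U → ℝ^N`, with `U ⊆ ℝ^k` open, is a local parametrization of the set `S ⊆ ℝ^N`: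
a smooth injective immersion which is a homeomorphism onto a relatively open subset of `S`. -/
structure IsLocalParam {k N : ℕ} (S : Set (E N)) (U : Set (E k)) (φ : E k → E N) : Prop where
  isOpen : IsOpen U
  smooth : ContDiffOn ℝ ∞ φ U
  immersion : ∀ x ∈ U, Function.Injective (fderiv ℝ φ x)
  injOn : Set.InjOn φ U
  image_open : ∀ V ⊆ U, IsOpen V → ∃ W : Set (E N), IsOpen W ∧ φ '' V = S ∩ W

/-- `S` is a smooth embedded `k`-dimensional submanifold (without boundary) of `ℝ^N`. -/
def IsSmoothSubmanifold {N : ℕ} (k : ℕ) (S : Set (E N)) : Prop :=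
  ∀ p ∈ S, ∃ (U : Set (E k)) (φ : E k → E N), IsLocalParam S U φ ∧ p ∈ φ '' U

/-! ### Intrinsic curvature of the induced metric -/

/-- The first fundamental form (induced metric) `g_ij = ⟨∂_i φ, ∂_j φ⟩`. -/
def inducedMetric {k N : ℕ} (φ : E k → E N) (x : E k) : Matrix (Fin k) (Fin k) ℝ :=
  Matrix.of fun i j => inner ℝ (partialDeriv φ i x) (partialDeriv φ j x)

/-- The Christoffel symbol `Γ^l_ij` of the Levi-Civita connection of a metric `g` given in
coordinates. -/
def christoffel {k : ℕ} (g : E k → Matrix (Fin k) (Fin k) ℝ) (l i j : Fin k) (x : E k) : ℝ :=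
  (1 / 2) * ∑ m : Fin k, (g x)⁻¹ l m *
    (partialDeriv (fun y => g y j m) i x + partialDeriv (fun y => g y i m) j x
      - partialDeriv (fun y => g y i j) m x)

/-- The coefficient `R^l_kij` of the curvature tensor, where
`(∇_i ∇_j - ∇_j ∇_i) ∂_k = ∑ l, R^l_kij ∂_l`. -/
def riemann {d : ℕ} (g : E d → Matrix (Fin d) (Fin d) ℝ) (l k i j : Fin d) (x : E d) : ℝ :=
  partialDeriv (christoffel g l j k) i x - partialDeriv (christoffel g l i k) j x
    + ∑ m : Fin d, (christoffel g l i m x * christoffel g m j k x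
      - christoffel g l j m x * christoffel g m i k x)

/-- The Ricci tensor `Ric_jk = ∑ i, R^i_kij` (positive on round spheres). -/
def ricci {d : ℕ} (g : E d → Matrix (Fin d) (Fin d) ℝ) (j k : Fin d) (x : E d) : ℝ :=
  ∑ i : Fin d, riemann g i k i j x

/-- The `d`-dimensional submanifold `S` of `ℝ^N`, with the Riemannian metric induced from `ℝ^N`,
has positive Ricci curvature: `Ric(v, v) > 0` for every nonzero tangent vector `v`, expressed
in every local parametrization. -/
def HasPositiveRicci {N : ℕ} (d : ℕ) (S : Set (E N)) : Prop :=
  ∀ (U : Set (E d)) (φ : E d → E N), IsLocalParam S U φ → ∀ x ∈ U, ∀ v : E d, v ≠ 0 →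
    0 < ∑ i : Fin d, ∑ j : Fin d, ricci (inducedMetric φ) i j x * v i * v j

/-! ### Hypersurfaces of the unit sphere -/

/-- `M` is a smooth embedded hypersurface of the unit sphere `S^(n+1) ⊆ ℝ^(n+2)`. -/
structure IsSphereHypersurface (n : ℕ) (M : Set (E (n + 2))) : Prop where
  subset_sphere : M ⊆ Metric.sphere 0 1
  submanifold : IsSmoothSubmanifold n M

/-- `ν` is a smooth unit normal field of the hypersurface `M` in the unit sphere `S^(n+1)`:
a smooth field along `M` of unit vectors tangent to the sphere and orthogonal to `M`. -/
structure IsUnitNormalField (n : ℕ) (M : Set (E (n + 2))) (ν : E (n + 2) → E (n + 2)) :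
    Prop where
  smooth : ∀ (U : Set (E n)) (φ : E n → E (n + 2)), IsLocalParam M U φ →
    ContDiffOn ℝ ∞ (ν ∘ φ) U
  norm_eq_one : ∀ p ∈ M, ‖ν p‖ = 1
  tangent_sphere : ∀ p ∈ M, inner ℝ (ν p) p = 0
  normal : ∀ (U : Set (E n)) (φ : E n → E (n + 2)), IsLocalParam M U φ →
    ∀ x ∈ U, ∀ v : E n, inner ℝ (ν (φ x)) (fderiv ℝ φ x v) = 0

/-- The second fundamental form `h_ij = ⟨∂_i ∂_j φ, ν⟩ = -⟨∂_i (ν ∘ φ), ∂_j φ⟩` with respect to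
the unit normal field `ν`, in a local parametrization. -/
def secondForm {k N : ℕ} (ν : E N → E N) (φ : E k → E N) (x : E k) :
    Matrix (Fin k) (Fin k) ℝ :=
  Matrix.of fun i j => - inner ℝ (partialDeriv (ν ∘ φ) i x) (partialDeriv φ j x)

/-- The matrix `g⁻¹ h` of the shape operator with respect to `ν`, in the basis
`∂_1 φ, …, ∂_k φ` of the tangent space. -/
def shapeOperator {k N : ℕ} (ν : E N → E N) (φ : E k → E N) (x : E k) :
    Matrix (Fin k) (Fin k) ℝ :=
  (inducedMetric φ x)⁻¹ * secondForm ν φ x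

/-- The hypersurface `M` of the sphere with unit normal field `ν` is isoparametric with `g`
principal curvatures: at every point the principal curvatures (the eigenvalues of the shape
operator) are exactly the `g` distinct constants `κ 0, …, κ (g - 1)`, and `κ i` has
multiplicity `m i`. -/
structure IsIsoparametric (n : ℕ) (M : Set (E (n + 2))) (ν : E (n + 2) → E (n + 2))
    {g : ℕ} (κ : Fin g → ℝ) (m : Fin g → ℕ) : Prop where
  distinct : Function.Injective κ
  eigenvalues : ∀ (U : Set (E n)) (φ : E n → E (n + 2)), IsLocalParam M U φ → ∀ x ∈ U, ∀ r : ℝ,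
    Module.End.HasEigenvalue (Matrix.toLin' (shapeOperator ν φ x)) r ↔ ∃ i, r = κ i
  multiplicity : ∀ (U : Set (E n)) (φ : E n → E (n + 2)), IsLocalParam M U φ → ∀ x ∈ U,
    ∀ i, Module.finrank ℝ
      (Module.End.eigenspace (Matrix.toLin' (shapeOperator ν φ x)) (κ i)) = m i

/-- The hypersurface `M` of the sphere is minimal: its mean curvature vanishes. -/
def IsMinimal (n : ℕ) (M : Set (E (n + 2))) (ν : E (n + 2) → E (n + 2)) : Prop :=
  ∀ (U : Set (E n)) (φ : E n → E (n + 2)), IsLocalParam M U φ → ∀ x ∈ U,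
    (shapeOperator ν φ x).trace = 0

/-- The parallel set `M_t = {cos t • p + sin t • ν p | p ∈ M}` at oriented distance `t` in the
sphere; equivalently `{p + ξ p | p ∈ M}` for the parallel normal field
`ξ p = (cos t - 1) • p + sin t • ν p` of `M ⊆ ℝ^(n+2)`. -/
def parallelSet {N : ℕ} (M : Set (E N)) (ν : E N → E N) (t : ℝ) : Set (E N) :=
  (fun p => Real.cos t • p + Real.sin t • ν p) '' M

/-- `S` is a focal manifold of codimension `c` in `S^(n+1)` of the hypersurface `M`: it is one of
the sets `M_t`, it is a submanifold whose codimension in `S^(n+1)` is `c`, and its dimension is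
smaller than that of `M` (that is, `c > 1`). -/
def IsFocalManifold (n : ℕ) (M : Set (E (n + 2))) (ν : E (n + 2) → E (n + 2)) (c : ℕ)
    (S : Set (E (n + 2))) : Prop :=
  1 < c ∧ (∃ t : ℝ, S = parallelSet M ν t) ∧ ∃ d : ℕ, d + c = n + 1 ∧ IsSmoothSubmanifold d S

end FocalRicci

end

open scoped ContDiff

noncomputable section

namespace FocalRicci

/-! ### Coordinate calculus -/

section Calculus

/-! At a point of the focal manifold let `A_α` be the shape operator, within the sphere, for a unit
normal `α`. The Gauss equation gives Ric(v,v) = (d - 1)|v|² + ∑ₐ (tr Aₐ ⟨Aₐ v, v⟩ - |Aₐ v|²) over an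
orthonormal normal basis, with d = n - m₁. If every `A_α` satisfies A³ = A and tr A = 0, each
summand is at least -|v|². There are m₁ + 1 normals, so Ric > 0 as soon as d > m₁ + 2
(`sum_ricci_pos`). The four multiplicities sum to at most n, so d ≥ 2m₁ + m₂; the hypothesis forces
m₂ ≥ 4, and this suffices.

The spectrum comes from the focal map F = cos t φ + sin t ν with cot t = κ_j, which collapses the
leaves of κ_j. Its companion η = -sin t φ + cos t ν is a unit normal of the focal set, and for it
the shape operator has eigenvalues (1 + κ_j κ_k)/(κ_j - κ_k), k ≠ j, the same at all points
(`second_eq`). As x moves in one leaf, the focal point stays fixed while η(x) sweeps an open set of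
unit normals (`eventually_exists_leaf`). Along a great circle of normals the relevant identities are
analytic, so they pass from this open set to every unit normal (`eq_zero_of_forall_leaf`).

Continued to -η, this shows that the three focal curvatures form a set symmetric about 0. This holds
for each of the four κ_j, and elementary algebra then forces the values -1, 0, 1
(`focalCurvature_pow_three`). Continuing A³ = A gives it for all normals. Such an A has integral
trace, which is continuous and odd along a great circle from α to -α, hence zero (`shape_trace`).

It remains to match the given submanifold with one κ_j of multiplicity m₁. A rank count bounds its
dimension below by n - m_j, and Hausdorff dimension bounds it above (`exists_isFocalFactorization`).
-/

theorem two_le_infty : (2 : WithTop ℕ∞) ≤ ∞ := WithTop.coe_le_coe.2 le_top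

variable {k N : ℕ} {F : Type*} [NormedAddCommGroup F] [NormedSpace ℝ F]

theorem contDiffOn_partialDeriv {f : E k → F} {U : Set (E k)} (hU : IsOpen U)
    (hf : ContDiffOn ℝ ∞ f U) (i : Fin k) : ContDiffOn ℝ ∞ (partialDeriv f i) U := by
  have h : ContDiffOn ℝ ∞ (fderiv ℝ f) U := hf.fderiv_of_isOpen hU (by simp)
  exact h.clm_apply contDiffOn_const

theorem partialDeriv_congr {f g : E k → F} {x : E k} (h : f =ᶠ[nhds x] g) (i : Fin k) :
    partialDeriv f i x = partialDeriv g i x := by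
  unfold partialDeriv; rw [h.fderiv_eq]

theorem partialDeriv_partialDeriv {f : E k → F} {x : E k} (hf : ContDiffAt ℝ 2 f x)
    (i j : Fin k) : partialDeriv (partialDeriv f j) i x =
      fderiv ℝ (fderiv ℝ f) x (EuclideanSpace.single i 1) (EuclideanSpace.single j 1) := by
  have h : DifferentiableAt ℝ (fderiv ℝ f) x :=
    (hf.fderiv_right (m := 1) (by norm_num)).differentiableAt (by norm_num)
  unfold partialDeriv
  rw [fderiv_clm_apply h (differentiableAt_const _)]
  simp

theorem partialDeriv_comm {f : E k → F} {x : E k} (hf : ContDiffAt ℝ 2 f x) (i j : Fin k) :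
    partialDeriv (partialDeriv f j) i x = partialDeriv (partialDeriv f i) j x := by
  rw [partialDeriv_partialDeriv hf, partialDeriv_partialDeriv hf]
  exact (hf.isSymmSndFDerivAt (by simp)) _ _

theorem partialDeriv_inner {a b : E k → E N} {x : E k} (ha : DifferentiableAt ℝ a x)
    (hb : DifferentiableAt ℝ b x) (i : Fin k) :
    partialDeriv (fun y => inner ℝ (a y) (b y)) i x =
      inner ℝ (a x) (partialDeriv b i x) + inner ℝ (partialDeriv a i x) (b x) := by
  unfold partialDeriv
  rw [fderiv_inner_apply ℝ ha hb]

theorem partialDeriv_mul {a b : E k → ℝ} {x : E k} (ha : DifferentiableAt ℝ a x)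
    (hb : DifferentiableAt ℝ b x) (i : Fin k) :
    partialDeriv (fun y => a y * b y) i x =
      a x * partialDeriv b i x + partialDeriv a i x * b x := by
  unfold partialDeriv
  rw [fderiv_fun_mul ha hb]
  simp [mul_comm]

theorem partialDeriv_sum {ι : Type*} (s : Finset ι) {a : ι → E k → ℝ} {x : E k}
    (ha : ∀ j ∈ s, DifferentiableAt ℝ (a j) x) (i : Fin k) :
    partialDeriv (fun y => ∑ j ∈ s, a j y) i x = ∑ j ∈ s, partialDeriv (a j) i x := by
  unfold partialDeriv
  rw [fderiv_fun_sum ha]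
  simp

/-- Cramer's rule: the entries of the inverse are quotients of determinants. This is what makes
Christoffel symbols differentiable. -/
theorem differentiableAt_matrix_inv {g : E k → Matrix (Fin k) (Fin k) ℝ} {x : E k}
    (hg : ∀ i j, DifferentiableAt ℝ (fun y => g y i j) x) (hdet : (g x).det ≠ 0) (i j : Fin k) :
    DifferentiableAt ℝ (fun y => (g y)⁻¹ i j) x := by
  have hd : ∀ h : E k → Matrix (Fin k) (Fin k) ℝ,
      (∀ i j, DifferentiableAt ℝ (fun y => h y i j) x) →
      DifferentiableAt ℝ (fun y => (h y).det) x := by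
    intro h hh
    simp only [Matrix.det_apply]
    refine DifferentiableAt.fun_sum fun σ _ => DifferentiableAt.const_smul ?_ _
    exact (HasFDerivAt.finsetProd (g := fun l y => h y (σ l) l)
      fun l _ => (hh _ _).hasFDerivAt).differentiableAt
  simp only [Matrix.inv_def, Ring.inverse_eq_inv', Matrix.smul_apply, smul_eq_mul,
    Matrix.adjugate_apply]
  refine ((hd g hg).inv hdet).mul (hd _ fun a b => ?_)
  by_cases hja : a = j
  · subst hja; simp
  · simpa [Matrix.updateRow_ne hja] using hg a b

end Calculus

/-! ### The Gauss equation in coordinates -/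

section Gauss

variable {d N : ℕ} {U : Set (E d)} {ψ : E d → E N}

theorem fderiv_eq_sum_partialDeriv (f : E d → E N) (x v : E d) :
    fderiv ℝ f x v = ∑ i, v i • partialDeriv f i x := by
  conv_lhs => rw [← (EuclideanSpace.basisFun (Fin d) ℝ).sum_repr v]
  simp [partialDeriv]

theorem inducedMetric_comm (ψ : E d → E N) (x : E d) (i j : Fin d) :
    inducedMetric ψ x i j = inducedMetric ψ x j i := by
  simp [inducedMetric, real_inner_comm]

theorem dotProduct_inducedMetric (ψ : E d → E N) (x v w : E d) :
    ∑ i, ∑ j, inducedMetric ψ x i j * v i * w j =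
      inner ℝ (fderiv ℝ ψ x v) (fderiv ℝ ψ x w) := by
  simp only [fderiv_eq_sum_partialDeriv, sum_inner, inner_sum, inner_smul_left, inner_smul_right,
    inducedMetric, Matrix.of_apply, Finset.mul_sum]
  rw [Finset.sum_comm]
  refine Finset.sum_congr rfl fun i _ => Finset.sum_congr rfl fun j _ => ?_
  simp; ring

theorem posDef_inducedMetric {x : E d} (h : Function.Injective (fderiv ℝ ψ x)) :
    (inducedMetric ψ x).PosDef := by
  refine Matrix.PosDef.of_dotProduct_mulVec_pos ?_ fun v hv => ?_
  · ext i j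
    simp [inducedMetric_comm ψ x i j]
  · have := dotProduct_inducedMetric ψ x (WithLp.toLp 2 v) (WithLp.toLp 2 v)
    have h2 : 0 < inner ℝ (fderiv ℝ ψ x (WithLp.toLp 2 v)) (fderiv ℝ ψ x (WithLp.toLp 2 v)) := by
      rw [real_inner_self_eq_norm_sq]
      have : fderiv ℝ ψ x (WithLp.toLp 2 v) ≠ 0 := by
        intro h0
        apply hv
        have := h (h0.trans (map_zero _).symm)
        simpa using this
      positivity
    rw [← this] at h2
    refine h2.trans_eq ?_
    simp only [dotProduct, Matrix.mulVec, Finset.mul_sum]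
    refine Finset.sum_congr rfl fun i _ => Finset.sum_congr rfl fun j _ => ?_
    rw [Pi.star_apply, star_trivial]; ring

/-- The inner product of the normal components of the second derivatives `∂_a ∂_b ψ` and
`∂_i ∂_j ψ`. -/
def normalGram (ψ : E d → E N) (x : E d) (a b i j : Fin d) : ℝ :=
  inner ℝ (partialDeriv (partialDeriv ψ b) a x) (partialDeriv (partialDeriv ψ j) i x)
    - ∑ l, ∑ m, (inducedMetric ψ x)⁻¹ l m *
      inner ℝ (partialDeriv (partialDeriv ψ b) a x) (partialDeriv ψ m x) *
      inner ℝ (partialDeriv (partialDeriv ψ j) i x) (partialDeriv ψ l x)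

theorem partialDeriv_inducedMetric (hU : IsOpen U) (hψ : ContDiffOn ℝ ∞ ψ U) {x : E d}
    (hx : x ∈ U) (i j l : Fin d) :
    partialDeriv (fun y => inducedMetric ψ y j l) i x =
      inner ℝ (partialDeriv ψ j x) (partialDeriv (partialDeriv ψ l) i x) +
      inner ℝ (partialDeriv (partialDeriv ψ j) i x) (partialDeriv ψ l x) := by
  have h := fun i => ((contDiffOn_partialDeriv hU hψ i).contDiffAt (hU.mem_nhds hx)).differentiableAt
    (by simp)
  exact partialDeriv_inner (h j) (h l) i

/-- In the Koszul combination of the three metric derivatives, symmetry of second derivatives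
cancels all but twice one term. -/
theorem christoffel_inducedMetric (hU : IsOpen U) (hψ : ContDiffOn ℝ ∞ ψ U) {x : E d}
    (hx : x ∈ U) (l i j : Fin d) :
    christoffel (inducedMetric ψ) l i j x = ∑ m, (inducedMetric ψ x)⁻¹ l m *
      inner ℝ (partialDeriv (partialDeriv ψ j) i x) (partialDeriv ψ m x) := by
  unfold christoffel
  rw [Finset.mul_sum]
  refine Finset.sum_congr rfl fun m _ => ?_
  have hc : ∀ i j, partialDeriv (partialDeriv ψ j) i x = partialDeriv (partialDeriv ψ i) j x :=
    partialDeriv_comm ((hψ.contDiffAt (hU.mem_nhds hx)).of_le two_le_infty)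
  rw [partialDeriv_inducedMetric hU hψ hx, partialDeriv_inducedMetric hU hψ hx,
    partialDeriv_inducedMetric hU hψ hx, hc i m, hc j m, hc j i,
    real_inner_comm (partialDeriv (partialDeriv ψ i) m x) (partialDeriv ψ j x)]
  ring

theorem sum_inducedMetric_christoffel (hU : IsOpen U) (hψ : ContDiffOn ℝ ∞ ψ U)
    (himm : ∀ x ∈ U, Function.Injective (fderiv ℝ ψ x)) {x : E d} (hx : x ∈ U) (p i j : Fin d) :
    ∑ l, inducedMetric ψ x p l * christoffel (inducedMetric ψ) l i j x =
      inner ℝ (partialDeriv (partialDeriv ψ j) i x) (partialDeriv ψ p x) := by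
  have hdet : IsUnit (inducedMetric ψ x).det :=
    (posDef_inducedMetric (himm x hx)).det_pos.ne'.isUnit
  simp only [christoffel_inducedMetric hU hψ hx]
  have := congrArg (fun v => v p) (Matrix.mulVec_mulVec
    (fun m => inner ℝ (partialDeriv (partialDeriv ψ j) i x) (partialDeriv ψ m x))
    (inducedMetric ψ x) (inducedMetric ψ x)⁻¹)
  rw [Matrix.mul_nonsing_inv _ hdet, Matrix.one_mulVec] at this
  exact this

/-- Half of the curvature tensor with its upper index lowered. The third derivative on the right is
symmetric in `i`, `j` and disappears on antisymmetrizing, leaving the Gauss equation. -/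
theorem sum_inducedMetric_partialDeriv_christoffel (hU : IsOpen U) (hψ : ContDiffOn ℝ ∞ ψ U)
    (himm : ∀ x ∈ U, Function.Injective (fderiv ℝ ψ x)) {x : E d} (hx : x ∈ U) (p i j k : Fin d) :
    ∑ l, inducedMetric ψ x p l * (partialDeriv (christoffel (inducedMetric ψ) l j k) i x +
      ∑ m, christoffel (inducedMetric ψ) l i m x * christoffel (inducedMetric ψ) m j k x) =
    inner ℝ (partialDeriv (partialDeriv (partialDeriv ψ k) j) i x) (partialDeriv ψ p x) +
      normalGram ψ x j k i p := by
  have hs1 := fun i => contDiffOn_partialDeriv hU hψ i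
  have hs2 := fun i j => contDiffOn_partialDeriv hU (hs1 j) i
  have hd1 := fun i => ((hs1 i).contDiffAt (hU.mem_nhds hx)).differentiableAt (by simp)
  have hd2 := fun i j => ((hs2 i j).contDiffAt (hU.mem_nhds hx)).differentiableAt (by simp)
  have hdet : (inducedMetric ψ x).det ≠ 0 := (posDef_inducedMetric (himm x hx)).det_pos.ne'
  have hg : ∀ i j, DifferentiableAt ℝ (fun y => inducedMetric ψ y i j) x := fun i j =>
    (hd1 i).inner ℝ (hd1 j)
  have hΓ : ∀ l, DifferentiableAt ℝ (christoffel (inducedMetric ψ) l j k) x := fun l => by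
    refine DifferentiableAt.congr_of_eventuallyEq (f := fun y => ∑ m, (inducedMetric ψ y)⁻¹ l m *
      inner ℝ (partialDeriv (partialDeriv ψ k) j y) (partialDeriv ψ m y)) ?_ ?_
    · refine DifferentiableAt.fun_sum fun m _ => ?_
      exact (differentiableAt_matrix_inv hg hdet _ _).mul ((hd2 _ _).inner ℝ (hd1 _))
    · filter_upwards [hU.mem_nhds hx] with y hy using christoffel_inducedMetric hU hψ hy _ _ _
  -- The lowered identity g Γ = ⟨∂∂ψ, ∂ψ⟩ holds on all of `U`, so it can be differentiated at `x`.
  have key : partialDeriv (fun y => ∑ l, inducedMetric ψ y p l *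
      christoffel (inducedMetric ψ) l j k y) i x = partialDeriv (fun y =>
      inner ℝ (partialDeriv (partialDeriv ψ k) j y) (partialDeriv ψ p y)) i x := by
    refine partialDeriv_congr ?_ i
    filter_upwards [hU.mem_nhds hx] with y hy
      using sum_inducedMetric_christoffel hU hψ himm hy _ _ _
  rw [partialDeriv_sum _ (fun l _ => (hg p l).fun_mul (hΓ l)), partialDeriv_inner (hd2 _ _) (hd1 _)]
    at key
  have h1 : ∀ l, partialDeriv (fun y => inducedMetric ψ y p l *
      christoffel (inducedMetric ψ) l j k y) i x =
      inducedMetric ψ x p l * partialDeriv (christoffel (inducedMetric ψ) l j k) i x +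
      ((inner ℝ (partialDeriv ψ p x) (partialDeriv (partialDeriv ψ l) i x) +
      inner ℝ (partialDeriv (partialDeriv ψ p) i x) (partialDeriv ψ l x))) *
      christoffel (inducedMetric ψ) l j k x := fun l => by
    rw [partialDeriv_mul (hg p l) (hΓ l), partialDeriv_inducedMetric hU hψ hx]
  simp only [h1, Finset.sum_add_distrib, add_mul] at key
  -- One half of ∂g is again of the form g Γ and produces the quadratic Christoffel term.
  have h2 : ∑ l, inner ℝ (partialDeriv ψ p x) (partialDeriv (partialDeriv ψ l) i x) *
      christoffel (inducedMetric ψ) l j k x = ∑ l, inducedMetric ψ x p l *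
      ∑ m, christoffel (inducedMetric ψ) l i m x * christoffel (inducedMetric ψ) m j k x := by
    simp only [Finset.mul_sum]
    rw [Finset.sum_comm]
    refine Finset.sum_congr rfl fun l _ => ?_
    rw [real_inner_comm, ← sum_inducedMetric_christoffel hU hψ himm hx, Finset.sum_mul]
    exact Finset.sum_congr rfl fun m _ => mul_assoc _ _ _
  -- The other half is the tangential correction subtracted in `normalGram`.
  have h3 : ∑ l, inner ℝ (partialDeriv (partialDeriv ψ p) i x) (partialDeriv ψ l x) *
      christoffel (inducedMetric ψ) l j k x = ∑ l, ∑ m, (inducedMetric ψ x)⁻¹ l m *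
      inner ℝ (partialDeriv (partialDeriv ψ k) j x) (partialDeriv ψ m x) *
      inner ℝ (partialDeriv (partialDeriv ψ p) i x) (partialDeriv ψ l x) := by
    refine Finset.sum_congr rfl fun l _ => ?_
    rw [christoffel_inducedMetric hU hψ hx, Finset.mul_sum]
    exact Finset.sum_congr rfl fun m _ => by ring
  rw [h2, h3] at key
  simp only [mul_add, Finset.sum_add_distrib, normalGram]
  linarith

/-- The Gauss equation. -/
theorem sum_inducedMetric_riemann (hU : IsOpen U) (hψ : ContDiffOn ℝ ∞ ψ U)
    (himm : ∀ x ∈ U, Function.Injective (fderiv ℝ ψ x)) {x : E d} (hx : x ∈ U) (p k i j : Fin d) :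
    ∑ l, inducedMetric ψ x p l * riemann (inducedMetric ψ) l k i j x =
      normalGram ψ x j k i p - normalGram ψ x i k j p := by
  have h1 := sum_inducedMetric_partialDeriv_christoffel hU hψ himm hx p i j k
  have h2 := sum_inducedMetric_partialDeriv_christoffel hU hψ himm hx p j i k
  have h3 : partialDeriv (partialDeriv (partialDeriv ψ k) j) i x =
      partialDeriv (partialDeriv (partialDeriv ψ k) i) j x :=
    partialDeriv_comm (((contDiffOn_partialDeriv hU hψ k).contDiffAt
      (hU.mem_nhds hx)).of_le two_le_infty) _ _
  rw [h3] at h1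
  have : ∀ l, inducedMetric ψ x p l * riemann (inducedMetric ψ) l k i j x =
      inducedMetric ψ x p l * (partialDeriv (christoffel (inducedMetric ψ) l j k) i x +
      ∑ m, christoffel (inducedMetric ψ) l i m x * christoffel (inducedMetric ψ) m j k x) -
      inducedMetric ψ x p l * (partialDeriv (christoffel (inducedMetric ψ) l i k) j x +
      ∑ m, christoffel (inducedMetric ψ) l j m x * christoffel (inducedMetric ψ) m i k x) := by
    intro l
    rw [riemann, Finset.sum_sub_distrib]
    ring
  simp only [this, Finset.sum_sub_distrib, h1, h2]
  ring

theorem ricci_inducedMetric (hU : IsOpen U) (hψ : ContDiffOn ℝ ∞ ψ U)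
    (himm : ∀ x ∈ U, Function.Injective (fderiv ℝ ψ x)) {x : E d} (hx : x ∈ U) (j k : Fin d) :
    ricci (inducedMetric ψ) j k x = ∑ i, ∑ p, (inducedMetric ψ x)⁻¹ i p *
      (normalGram ψ x j k i p - normalGram ψ x i k j p) := by
  have hdet : IsUnit (inducedMetric ψ x).det :=
    (posDef_inducedMetric (himm x hx)).det_pos.ne'.isUnit
  unfold ricci
  refine Finset.sum_congr rfl fun i _ => ?_
  have := congrArg (fun v => v i) (Matrix.mulVec_mulVec
    (fun l => riemann (inducedMetric ψ) l k i j x)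
    (inducedMetric ψ x)⁻¹ (inducedMetric ψ x))
  rw [Matrix.nonsing_inv_mul _ hdet, Matrix.one_mulVec] at this
  rw [← this]
  simp only [Matrix.mulVec, dotProduct, sum_inducedMetric_riemann hU hψ himm hx]

end Gauss

/-! ### Shape operators as matrices, and the Ricci quadratic form -/

section LinearAlgebra

open Matrix

variable {d : ℕ}

/-- This is |Av|² ≤ |v|² in the metric `g`, for A = g⁻¹H: since A³ = A, the matrix 1 - A² is a
`g`-orthogonal projection, hence nonnegative. -/
theorem dotProduct_mulVec_le_of_pow_three {g H : Matrix (Fin d) (Fin d) ℝ} (hg : g.PosDef)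
    (hH : Hᵀ = H) (hA : (g⁻¹ * H) ^ 3 = g⁻¹ * H) (v : Fin d → ℝ) :
    v ⬝ᵥ (H * g⁻¹ * H) *ᵥ v ≤ v ⬝ᵥ g *ᵥ v := by
  have hdet : IsUnit g.det := hg.det_pos.ne'.isUnit
  have hgT : gᵀ = g := by simpa using hg.isHermitian.eq
  set A := g⁻¹ * H with hAdef
  have hgA : g * A = H := by rw [hAdef, ← mul_assoc, mul_nonsing_inv _ hdet, one_mul]
  have hAT : Aᵀ * g = H := by
    have h := transpose_mul g A
    rw [hgA, hH, hgT] at h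
    exact h.symm
  set P := 1 - A ^ 2 with hP
  have hPP : P * P = P := by
    have h4 : A ^ 2 * A ^ 2 = A ^ 2 := by
      rw [← pow_add, show 2 + 2 = 3 + 1 from rfl, pow_succ, hA, pow_two]
    rw [hP, sub_mul, mul_sub, mul_sub, h4]; simp
  have hgP : g * P = g - H * g⁻¹ * H := by
    rw [hP, mul_sub, mul_one, pow_two, ← mul_assoc, hgA, hAdef, mul_assoc]
  have hPg : Pᵀ * g = g * P := by
    rw [hgP, hP, transpose_sub, transpose_one, sub_mul, one_mul, transpose_pow, pow_two, mul_assoc,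
      hAT]
    congr 1
    rw [hAdef, transpose_mul, hH, transpose_nonsing_inv, hgT]
  have hpsd := (hg.posSemidef.conjTranspose_mul_mul_same P).dotProduct_mulVec_nonneg v
  rw [conjTranspose_eq_transpose_of_trivial, hPg, mul_assoc, hPP, hgP, sub_mulVec,
    dotProduct_sub] at hpsd
  simp only [star_trivial] at hpsd
  linarith

/-- The contribution of one normal direction to Ric(v,v): tr A ⟨Av, v⟩ - |Av|² for A = g⁻¹H. -/
theorem sum_curvature_quadratic {g H : Matrix (Fin d) (Fin d) ℝ} (hH : Hᵀ = H)
    (v : Fin d → ℝ) :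
    ∑ j, ∑ k, (∑ i, ∑ p, g⁻¹ i p * (H j k * H i p - H i k * H j p)) * v j * v k =
      (g⁻¹ * H).trace * (v ⬝ᵥ H *ᵥ v) - v ⬝ᵥ (H * g⁻¹ * H) *ᵥ v := by
  have hs : ∀ i j, H i j = H j i := fun i j => congrFun (congrFun hH.symm i) j
  have e1 : (g⁻¹ * H).trace = ∑ i, ∑ p, g⁻¹ i p * H i p := by
    simp only [trace, diag_apply, mul_apply]
    exact Finset.sum_congr rfl fun i _ => Finset.sum_congr rfl fun p _ => by rw [hs p i]
  have e2 : v ⬝ᵥ H *ᵥ v = ∑ j, ∑ k, H j k * v j * v k := by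
    simp only [dotProduct, mulVec, Finset.mul_sum]
    exact Finset.sum_congr rfl fun i _ => Finset.sum_congr rfl fun p _ => by ring
  have e3 : v ⬝ᵥ (H * g⁻¹ * H) *ᵥ v =
      ∑ j, ∑ k, ∑ i, ∑ p, g⁻¹ i p * (H i k * H j p) * v j * v k := by
    rw [← mulVec_mulVec, ← mulVec_mulVec, dotProduct_mulVec]
    have : v ᵥ* H = H *ᵥ v := by rw [← hH, vecMul_transpose, hH]
    rw [this]
    have h1 : ∀ i, (H *ᵥ v) i = ∑ k, H i k * v k := fun i => rfl
    have h2 : H *ᵥ v ⬝ᵥ g⁻¹ *ᵥ H *ᵥ v = ∑ i, ∑ p, g⁻¹ i p * (H *ᵥ v) i * (H *ᵥ v) p := by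
      generalize H *ᵥ v = y
      simp only [dotProduct, mulVec, Finset.mul_sum]
      exact Finset.sum_congr rfl fun i _ => Finset.sum_congr rfl fun p _ => by ring
    rw [h2]
    calc _ = ∑ i, ∑ p, ∑ j, ∑ k, g⁻¹ i p * (H i k * H j p) * v j * v k := by
          refine Finset.sum_congr rfl fun i _ => Finset.sum_congr rfl fun p _ => ?_
          rw [h1, h1, mul_assoc, mul_comm (∑ k, _), Finset.sum_mul_sum, Finset.mul_sum]
          refine Finset.sum_congr rfl fun j _ => ?_
          rw [Finset.mul_sum]
          refine Finset.sum_congr rfl fun k _ => ?_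
          rw [hs p j]; ring
      _ = ∑ i, ∑ j, ∑ p, ∑ k, g⁻¹ i p * (H i k * H j p) * v j * v k :=
          Finset.sum_congr rfl fun i _ => Finset.sum_comm
      _ = ∑ i, ∑ j, ∑ k, ∑ p, g⁻¹ i p * (H i k * H j p) * v j * v k :=
          Finset.sum_congr rfl fun i _ => Finset.sum_congr rfl fun j _ => Finset.sum_comm
      _ = ∑ j, ∑ i, ∑ k, ∑ p, g⁻¹ i p * (H i k * H j p) * v j * v k := Finset.sum_comm
      _ = _ := Finset.sum_congr rfl fun j _ => Finset.sum_comm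
  rw [e1, e2, e3, Finset.mul_sum, ← Finset.sum_sub_distrib]
  refine Finset.sum_congr rfl fun j _ => ?_
  rw [Finset.mul_sum, ← Finset.sum_sub_distrib]
  refine Finset.sum_congr rfl fun k _ => ?_
  simp only [Finset.sum_mul, ← Finset.sum_sub_distrib]
  exact Finset.sum_congr rfl fun i _ => Finset.sum_congr rfl fun p _ => by ring

theorem sum_curvature_quadratic_family {ι : Type*} [Fintype ι] {g : Matrix (Fin d) (Fin d) ℝ}
    {H : ι → Matrix (Fin d) (Fin d) ℝ} (hH : ∀ a, (H a)ᵀ = H a) (v : Fin d → ℝ) :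
    ∑ j, ∑ k, (∑ i, ∑ p, g⁻¹ i p *
      (∑ a, H a j k * H a i p - ∑ a, H a i k * H a j p)) * v j * v k =
      ∑ a, ((g⁻¹ * H a).trace * (v ⬝ᵥ H a *ᵥ v) - v ⬝ᵥ (H a * g⁻¹ * H a) *ᵥ v) := by
  simp only [← sum_curvature_quadratic (hH _)]
  conv_rhs => rw [Finset.sum_comm]
  refine Finset.sum_congr rfl fun j _ => ?_
  conv_rhs => rw [Finset.sum_comm]
  refine Finset.sum_congr rfl fun k _ => ?_
  simp only [← Finset.sum_mul, ← Finset.sum_sub_distrib, Finset.mul_sum]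
  congr 2
  conv_rhs => rw [Finset.sum_comm]
  exact Finset.sum_congr rfl fun i _ => Finset.sum_comm

end LinearAlgebra

/-! ### Normal spaces and the Ricci bound for spherical submanifolds -/

section Normal

variable {d N : ℕ} {U : Set (E d)} {ψ : E d → E N}

/-- The normal space at `ψ x` of the image of `ψ` in the unit sphere. -/
def normalSpace (ψ : E d → E N) (x : E d) : Submodule ℝ (E N) :=
  ((LinearMap.range (fderiv ℝ ψ x).toLinearMap) ⊔ (ℝ ∙ ψ x))ᗮ

/-- The second fundamental form of `ψ` in the direction `α`. -/
def normalForm (ψ : E d → E N) (x : E d) (α : E N) : Matrix (Fin d) (Fin d) ℝ :=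
  Matrix.of fun i j => inner ℝ (partialDeriv (partialDeriv ψ j) i x) α

theorem mem_normalSpace {x : E d} {α : E N} : α ∈ normalSpace ψ x ↔
    (∀ v, inner ℝ (fderiv ℝ ψ x v) α = 0) ∧ inner ℝ (ψ x) α = 0 := by
  rw [normalSpace, ← Submodule.inf_orthogonal, Submodule.mem_inf, Submodule.mem_orthogonal,
    Submodule.mem_orthogonal_singleton_iff_inner_right]
  simp

theorem finrank_normalSpace {x : E d} (himm : Function.Injective (fderiv ℝ ψ x))
    (hnorm : ‖ψ x‖ = 1) (horth : ∀ v, inner ℝ (fderiv ℝ ψ x v) (ψ x) = 0) :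
    Module.finrank ℝ (normalSpace ψ x) + (d + 1) = N := by
  have h0 : ψ x ≠ 0 := by intro h; simp [h] at hnorm
  have h1 : Module.finrank ℝ (LinearMap.range (fderiv ℝ ψ x).toLinearMap) = d := by
    rw [LinearMap.finrank_range_of_inj himm]; simp
  have h2 : Disjoint (LinearMap.range (fderiv ℝ ψ x).toLinearMap) (ℝ ∙ ψ x) := by
    rw [Submodule.disjoint_def]
    rintro _ ⟨v, rfl⟩ hv
    obtain ⟨c, hc⟩ := Submodule.mem_span_singleton.1 hv
    have := horth v
    rw [show fderiv ℝ ψ x v = c • ψ x from hc.symm, inner_smul_left, real_inner_self_eq_norm_sq,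
      hnorm] at this
    have hc0 : c = 0 := by simpa using this
    rw [← hc, hc0, zero_smul]
  have h3 := Submodule.finrank_sup_add_finrank_inf_eq
    (LinearMap.range (fderiv ℝ ψ x).toLinearMap) (ℝ ∙ ψ x)
  rw [h2.eq_bot, finrank_bot, h1, finrank_span_singleton h0] at h3
  have h4 := Submodule.finrank_add_finrank_orthogonal
    ((LinearMap.range (fderiv ℝ ψ x).toLinearMap) ⊔ (ℝ ∙ ψ x))
  rw [finrank_euclideanSpace_fin] at h4
  unfold normalSpace
  omega

/-- Parseval for the orthogonal splitting into tangent space, position vector and normal space in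
the sphere; the tangent frame is not orthonormal, whence g⁻¹. It rewrites `normalGram` through
second fundamental forms. -/
theorem inner_eq_sum_tangent_add_normal {x : E d} (himm : Function.Injective (fderiv ℝ ψ x))
    (hnorm : ‖ψ x‖ = 1) (horth : ∀ v, inner ℝ (fderiv ℝ ψ x v) (ψ x) = 0)
    {ι : Type*} [Fintype ι] (b : OrthonormalBasis ι ℝ (normalSpace ψ x)) (u w : E N) :
    inner ℝ u w = (∑ l, ∑ m, (inducedMetric ψ x)⁻¹ l m * inner ℝ u (partialDeriv ψ m x) *
      inner ℝ w (partialDeriv ψ l x)) + (inner ℝ u (ψ x) * inner ℝ w (ψ x) +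
      ∑ a, inner ℝ u (b a : E N) * inner ℝ w (b a : E N)) := by
  classical
  have hdet : IsUnit (inducedMetric ψ x).det := (posDef_inducedMetric himm).det_pos.ne'.isUnit
  have hb : ∀ a, (∀ v, inner ℝ (fderiv ℝ ψ x v) (b a : E N) = 0) ∧ inner ℝ (ψ x) (b a : E N) = 0 :=
    fun a => mem_normalSpace.1 (b a).2
  have hon : ∀ a a', inner ℝ (b a : E N) (b a' : E N) = if a = a' then (1 : ℝ) else 0 :=
    fun a a' => orthonormal_iff_ite.1 b.orthonormal a a'
  -- `z` is what should be the tangential part of `w`; tangency follows from biorthogonality.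
  set z := w - (inner ℝ w (ψ x) • ψ x + ∑ a, inner ℝ w (b a : E N) • (b a : E N)) with hz
  have hzq : inner ℝ z (ψ x) = 0 := by
    simp [hz, inner_sub_left, inner_add_left, sum_inner, inner_smul_left, hnorm,
      real_inner_comm (ψ x) (b _ : E N), (hb _).2]
  have hzb : ∀ a, inner ℝ z (b a : E N) = 0 := fun a => by
    simp [hz, inner_sub_left, inner_add_left, sum_inner, inner_smul_left, (hb _).2, hon]
  have hzV : z ∈ (normalSpace ψ x)ᗮ := by
    rw [Submodule.mem_orthogonal']
    intro u hu
    have := b.sum_repr ⟨u, hu⟩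
    have h2 : u = ∑ a, b.repr ⟨u, hu⟩ a • (b a : E N) := by
      have h3 := congrArg (Subtype.val) this
      rw [Submodule.coe_sum] at h3
      simpa using h3.symm
    rw [h2, inner_sum]
    refine Finset.sum_eq_zero fun a _ => ?_
    rw [inner_smul_right, hzb, mul_zero]
  rw [normalSpace, Submodule.orthogonal_orthogonal, Submodule.mem_sup] at hzV
  obtain ⟨_, ⟨c, rfl⟩, y, hy, hcy⟩ := hzV
  obtain ⟨r, rfl⟩ := Submodule.mem_span_singleton.1 hy
  have hr : r = 0 := by
    rw [← hcy, inner_add_left, inner_smul_left] at hzq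
    simpa [horth, hnorm] using hzq
  rw [hr, zero_smul, add_zero] at hcy
  have hcy' : fderiv ℝ ψ x c = z := hcy
  have hw : w = fderiv ℝ ψ x c + (inner ℝ w (ψ x) • ψ x +
      ∑ a, inner ℝ w (b a : E N) • (b a : E N)) := by rw [hcy', hz]; abel
  have hwl : ∀ l, inner ℝ w (partialDeriv ψ l x) = ∑ k, inducedMetric ψ x l k * c k := by
    intro l
    have hl1 : inner ℝ (ψ x) (partialDeriv ψ l x) = 0 := by
      rw [real_inner_comm]; exact horth _
    have hl2 : ∀ a, inner ℝ (b a : E N) (partialDeriv ψ l x) = 0 := fun a => by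
      rw [real_inner_comm]; exact (hb a).1 _
    rw [hw, inner_add_left, inner_add_left, sum_inner, inner_smul_left, hl1,
      Finset.sum_eq_zero (fun a _ => by rw [inner_smul_left, hl2, mul_zero]),
      fderiv_eq_sum_partialDeriv, sum_inner]
    simp only [inner_smul_left, inducedMetric, Matrix.of_apply, mul_zero, add_zero]
    refine Finset.sum_congr rfl fun k _ => ?_
    rw [real_inner_comm, mul_comm]; rfl
  have hcm : ∀ m, c m = ∑ l, (inducedMetric ψ x)⁻¹ m l * inner ℝ w (partialDeriv ψ l x) := by
    intro m
    simp only [hwl]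
    have := congrArg (fun v => v m) (Matrix.mulVec_mulVec (fun k => c k)
      (inducedMetric ψ x)⁻¹ (inducedMetric ψ x))
    rw [Matrix.nonsing_inv_mul _ hdet, Matrix.one_mulVec] at this
    exact this.symm
  have hsymm : ∀ l m, (inducedMetric ψ x)⁻¹ l m = (inducedMetric ψ x)⁻¹ m l := by
    intro l m
    have : (inducedMetric ψ x).transpose = inducedMetric ψ x := by
      ext i j; exact inducedMetric_comm ψ x j i
    conv_lhs => rw [← this, ← Matrix.transpose_nonsing_inv]
    rfl
  have hmain : inner ℝ u w = inner ℝ u (fderiv ℝ ψ x c) + (inner ℝ u (ψ x) * inner ℝ w (ψ x) +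
      ∑ a, inner ℝ u (b a : E N) * inner ℝ w (b a : E N)) := by
    conv_lhs => rw [hw]
    rw [inner_add_right, inner_add_right, inner_sum, inner_smul_right]
    simp only [inner_smul_right]
    congr 2
    · ring
    · exact Finset.sum_congr rfl fun a _ => mul_comm _ _
  rw [hmain, fderiv_eq_sum_partialDeriv, inner_sum, Finset.sum_comm]
  congr 1
  refine Finset.sum_congr rfl fun m _ => ?_
  rw [inner_smul_right, hcm, Finset.sum_mul]
  exact Finset.sum_congr rfl fun l _ => by rw [hsymm l m]; ring

theorem inner_fderiv_add_eq_zero {f h : E d → E N} {c : ℝ} {y : E d} (hf : DifferentiableAt ℝ f y)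
    (hh : DifferentiableAt ℝ h y) (hc : ∀ᶠ z in nhds y, inner ℝ (f z) (h z) = c) (v : E d) :
    inner ℝ (f y) (fderiv ℝ h y v) + inner ℝ (fderiv ℝ f y v) (h y) = 0 := by
  have h1 : (fun y => inner ℝ (f y) (h y)) =ᶠ[nhds y] fun _ => c := hc
  rw [← fderiv_inner_apply ℝ hf hh, h1.fderiv_eq]
  simp

theorem inner_fderiv_self_eq_zero {f : E d → E N} {y : E d} (hf : DifferentiableAt ℝ f y)
    (h1 : ∀ᶠ z in nhds y, ‖f z‖ = 1) (v : E d) : inner ℝ (fderiv ℝ f y v) (f y) = 0 := by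
  have h := inner_fderiv_add_eq_zero (c := 1) hf hf
    (h1.mono fun z hz => by rw [real_inner_self_eq_norm_sq, hz, one_pow]) v
  rw [real_inner_comm (fderiv ℝ f y v)] at h
  linarith

/-- Positivity of the Ricci curvature of a spherical submanifold of small codimension, all of whose
shape operators are traceless with eigenvalues in `{-1, 0, 1}`. -/
theorem sum_ricci_pos (hU : IsOpen U) (hψ : ContDiffOn ℝ ∞ ψ U)
    (himm : ∀ x ∈ U, Function.Injective (fderiv ℝ ψ x)) (hnorm : ∀ x ∈ U, ‖ψ x‖ = 1)
    {x : E d} (hx : x ∈ U)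
    (hshape : ∀ α ∈ normalSpace ψ x, ‖α‖ = 1 →
      ((inducedMetric ψ x)⁻¹ * normalForm ψ x α) ^ 3 = (inducedMetric ψ x)⁻¹ * normalForm ψ x α ∧
      ((inducedMetric ψ x)⁻¹ * normalForm ψ x α).trace = 0)
    (hdim : Module.finrank ℝ (normalSpace ψ x) + 1 < d) {v : E d} (hv : v ≠ 0) :
    0 < ∑ i, ∑ j, ricci (inducedMetric ψ) i j x * v i * v j := by
  have hdiff : ∀ y ∈ U, DifferentiableAt ℝ ψ y := fun y hy =>
    (hψ.contDiffAt (hU.mem_nhds hy)).differentiableAt (by simp)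
  have hd1 : ∀ y ∈ U, ∀ i, DifferentiableAt ℝ (partialDeriv ψ i) y := fun y hy i =>
    ((contDiffOn_partialDeriv hU hψ i).contDiffAt (hU.mem_nhds hy)).differentiableAt (by simp)
  have horth : ∀ y ∈ U, ∀ v, inner ℝ (fderiv ℝ ψ y v) (ψ y) = 0 := by
    intro y hy v
    refine inner_fderiv_self_eq_zero (hdiff y hy) ?_ v
    filter_upwards [hU.mem_nhds hy] with z hz using hnorm z hz
  -- The position vector is a further Euclidean normal, with second form -g; it carries the
  -- curvature of the ambient sphere.
  have hq : ∀ i j, inner ℝ (partialDeriv (partialDeriv ψ j) i x) (ψ x) =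
      - inducedMetric ψ x i j := by
    intro i j
    have h1 : partialDeriv (fun y => inner ℝ (partialDeriv ψ j y) (ψ y)) i x =
        partialDeriv (fun _ => (0 : ℝ)) i x := by
      refine partialDeriv_congr ?_ i
      filter_upwards [hU.mem_nhds hx] with z hz using horth z hz _
    rw [partialDeriv_inner (hd1 x hx j) (hdiff x hx)] at h1
    have h2 : partialDeriv (fun _ : E d => (0 : ℝ)) i x = 0 := by simp [partialDeriv]
    rw [h2, real_inner_comm] at h1
    simp only [inducedMetric, Matrix.of_apply]
    linarith
  set b := stdOrthonormalBasis ℝ (normalSpace ψ x)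
  have hgram : ∀ j k i p, normalGram ψ x j k i p = inducedMetric ψ x j k * inducedMetric ψ x i p +
      ∑ a, normalForm ψ x (b a) j k * normalForm ψ x (b a) i p := by
    intro j k i p
    have := inner_eq_sum_tangent_add_normal (himm x hx) (hnorm x hx) (horth x hx) b
      (partialDeriv (partialDeriv ψ k) j x) (partialDeriv (partialDeriv ψ p) i x)
    rw [normalGram, this, hq, hq]
    simp only [normalForm, Matrix.of_apply]
    ring
  have hpd := posDef_inducedMetric (himm x hx)
  set g := inducedMetric ψ x with hg
  have hgT : g.transpose = g := by ext i j; exact inducedMetric_comm ψ x j i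
  have hHT : ∀ α, (normalForm ψ x α).transpose = normalForm ψ x α := by
    intro α
    ext i j
    simp only [normalForm, Matrix.transpose_apply, Matrix.of_apply]
    rw [partialDeriv_comm ((hψ.contDiffAt (hU.mem_nhds hx)).of_le two_le_infty)]
  have hdet : IsUnit g.det := hpd.det_pos.ne'.isUnit
  have hric : ∑ i, ∑ j, ricci (inducedMetric ψ) i j x * v i * v j =
      ((g⁻¹ * g).trace * (v.ofLp ⬝ᵥ g.mulVec v) - v.ofLp ⬝ᵥ (g * g⁻¹ * g).mulVec v) +
      ∑ a, ((g⁻¹ * normalForm ψ x (b a)).trace * (v.ofLp ⬝ᵥ (normalForm ψ x (b a)).mulVec v) -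
        v.ofLp ⬝ᵥ (normalForm ψ x (b a) * g⁻¹ * normalForm ψ x (b a)).mulVec v) := by
    -- `none` stands for the position vector. Its form enters quadratically, so `g` may replace -g.
    have h := sum_curvature_quadratic_family (g := g)
      (H := fun a : Option _ => a.elim g fun a => normalForm ψ x (b a))
      (by rintro (_ | a); exacts [hgT, hHT _]) v
    simp only [Fintype.sum_option, Option.elim] at h
    rw [← h]
    refine Finset.sum_congr rfl fun j _ => Finset.sum_congr rfl fun k _ => ?_
    rw [ricci_inducedMetric hU hψ himm hx]
    simp only [hgram]
    rfl
  have hvg : 0 < v.ofLp ⬝ᵥ g.mulVec v := by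
    have := hpd.dotProduct_mulVec_pos (x := v.ofLp) (by simpa using hv)
    simpa using this
  have hnb : ∀ a, ‖(b a : E N)‖ = 1 := fun a => b.orthonormal.1 a
  have hbound : ∀ a, -(v.ofLp ⬝ᵥ g.mulVec v) ≤
      (g⁻¹ * normalForm ψ x (b a)).trace * (v.ofLp ⬝ᵥ (normalForm ψ x (b a)).mulVec v) -
        v.ofLp ⬝ᵥ (normalForm ψ x (b a) * g⁻¹ * normalForm ψ x (b a)).mulVec v := by
    intro a
    obtain ⟨h1, h2⟩ := hshape _ (b a).2 (hnb a)
    have := dotProduct_mulVec_le_of_pow_three hpd (hHT (b a)) h1 v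
    rw [h2]
    linarith
  have hsum := Finset.sum_le_sum fun a (_ : a ∈ Finset.univ) => hbound a
  rw [hric, Matrix.nonsing_inv_mul _ hdet, Matrix.mul_nonsing_inv _ hdet, one_mul]
  simp only [Finset.sum_const, Finset.card_univ, Fintype.card_fin, nsmul_eq_mul] at hsum
  rw [Matrix.trace_one, Fintype.card_fin]
  -- The sphere contributes d - 1 times |v|², and each normal direction at least -|v|².
  have hd' : (Module.finrank ℝ (normalSpace ψ x) : ℝ) + 1 < d := by exact_mod_cast hdim
  nlinarith

end Normal

/-! ### Constant rank theorem and lifting to parametrizations -/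

section RankTheorem

open Filter Topology

variable {n N d r : ℕ}

/-- The constant rank theorem. -/
theorem exists_factorization_of_finrank_range_eq {F : E n → E N} {x₀ : E n}
    (hF : ContDiffAt ℝ 2 F x₀)
    (hr : ∀ᶠ x in 𝓝 x₀, Module.finrank ℝ (LinearMap.range (fderiv ℝ F x).toLinearMap) = r) :
    ∃ (π : E n → E r) (ψ : E r → E N), ContDiffAt ℝ 2 π x₀ ∧ ContDiffAt ℝ 2 ψ (π x₀) ∧
      F =ᶠ[𝓝 x₀] ψ ∘ π := by
  set T := LinearMap.range (fderiv ℝ F x₀).toLinearMap with hT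
  set K := LinearMap.ker (fderiv ℝ F x₀).toLinearMap with hK
  have hTr : Module.finrank ℝ T = r := hr.self_of_nhds
  let b : OrthonormalBasis (Fin r) ℝ T := (stdOrthonormalBasis ℝ T).reindex (finCongr hTr)
  let P : E N →L[ℝ] E r := (b.repr.toContinuousLinearEquiv : T →L[ℝ] E r) ∘L
    T.orthogonalProjectionOnto
  have hP : ∀ v ∈ T, P v = 0 → v = 0 := by
    intro v hv h
    have h1 : b.repr (T.orthogonalProjectionOnto v) = 0 := h
    rw [map_eq_zero_iff _ b.repr.injective] at h1
    have h2 := Submodule.orthogonalProjectionOnto_mem_subspace_eq_self (K := T) ⟨v, hv⟩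
    rw [h1] at h2
    exact (congrArg Subtype.val h2).symm
  -- Coordinates straightening `F`: the `P`-part of its value, completed by the component along the
  -- kernel at `x₀`.
  let G : E n → E r × K := fun x => (P (F x), K.orthogonalProjectionOnto x)
  have hdF : ∀ᶠ x in 𝓝 x₀, DifferentiableAt ℝ F x :=
    (hF.eventually (by simp)).mono fun x hx => hx.differentiableAt (by simp)
  have hGd : ∀ x, DifferentiableAt ℝ F x → HasFDerivAt G
      ((P ∘L fderiv ℝ F x).prod K.orthogonalProjectionOnto) x := fun x hx =>
    (P.hasFDerivAt.comp x hx.hasFDerivAt).prodMk K.orthogonalProjectionOnto.hasFDerivAt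
  have hG : ContDiffAt ℝ 2 G x₀ :=
    (P.contDiff.contDiffAt.comp x₀ hF).prodMk K.orthogonalProjectionOnto.contDiff.contDiffAt
  set G' := (P ∘L fderiv ℝ F x₀).prod K.orthogonalProjectionOnto with hG'
  have hinj : Function.Injective G'.toLinearMap := by
    rw [← LinearMap.ker_eq_bot, LinearMap.ker_eq_bot']
    intro v hv
    have h1 : P (fderiv ℝ F x₀ v) = 0 := congrArg Prod.fst hv
    have h2 : K.orthogonalProjectionOnto v = 0 := congrArg Prod.snd hv
    have h3 : v ∈ K := hP _ ⟨v, rfl⟩ h1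
    have h4 := Submodule.orthogonalProjectionOnto_mem_subspace_eq_self (K := K) ⟨v, h3⟩
    rw [h2] at h4
    exact (congrArg Subtype.val h4).symm
  have hfr : Module.finrank ℝ (E n) = Module.finrank ℝ (E r × K) := by
    have := LinearMap.finrank_range_add_finrank_ker (fderiv ℝ F x₀).toLinearMap
    rw [Module.finrank_prod, finrank_euclideanSpace_fin (n := r), ← this, ← hT, ← hK, hTr]
  let eG : E n ≃L[ℝ] E r × K :=
    (LinearEquiv.ofInjectiveOfFinrankEq G'.toLinearMap hinj hfr).toContinuousLinearEquiv
  have heG : HasFDerivAt G (eG : E n →L[ℝ] E r × K) x₀ := hGd x₀ hdF.self_of_nhds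
  let e := hG.toOpenPartialHomeomorph G heG (by simp)
  have hes : x₀ ∈ e.source := hG.mem_toOpenPartialHomeomorph_source heG (by simp)
  have het : G x₀ ∈ e.target := e.map_source hes
  have hex : e.symm (G x₀) = x₀ := e.left_inv hes
  have hsymm : ContDiffAt ℝ 2 e.symm (G x₀) := hG.to_localInverse heG (by simp)
  let Φ : E r × K → E N := F ∘ e.symm
  have hΦ : ContDiffAt ℝ 2 Φ (G x₀) := by
    refine ContDiffAt.comp (G x₀) ?_ hsymm
    rw [hex]; exact hF
  have htend : Tendsto e.symm (𝓝 (G x₀)) (𝓝 x₀) := by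
    have := hsymm.continuousAt.tendsto
    rwa [hex] at this
  -- In the new coordinates P ∘ Φ is the first projection. As the rank stays r, `P` is injective on
  -- nearby ranges of dF, so the derivative of Φ along `K`, killed by `P`, vanishes.
  have hzero : ∀ᶠ z in 𝓝 (G x₀), DifferentiableAt ℝ Φ z ∧ ∀ k : K, fderiv ℝ Φ z (0, k) = 0 := by
    filter_upwards [e.open_target.mem_nhds het,
      (hsymm.eventually (by simp)).mono fun x hx => hx.differentiableAt (n := 2) (by simp),
      htend.eventually hdF, htend.eventually hr] with z hz hd hdz hrz
    have hcomp : HasFDerivAt Φ (fderiv ℝ F (e.symm z) ∘L fderiv ℝ e.symm z) z :=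
      hdz.hasFDerivAt.comp z hd.hasFDerivAt
    refine ⟨hcomp.differentiableAt, fun k => ?_⟩
    rw [hcomp.fderiv]
    have hid : ((P ∘L fderiv ℝ F (e.symm z)).prod K.orthogonalProjectionOnto) ∘L
        fderiv ℝ e.symm z = ContinuousLinearMap.id ℝ (E r × K) := by
      refine ((hGd _ hdz).comp z hd.hasFDerivAt).unique ?_
      refine (hasFDerivAt_id z).congr_of_eventuallyEq ?_
      filter_upwards [e.open_target.mem_nhds hz] with w hw using e.right_inv hw
    have hid' : ∀ w, P (fderiv ℝ F (e.symm z) (fderiv ℝ e.symm z w)) = w.1 := fun w =>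
      congrArg Prod.fst (congrArg (fun L => L w) hid)
    let R := LinearMap.range (fderiv ℝ F (e.symm z)).toLinearMap
    have hsurj : Function.Surjective (P.toLinearMap ∘ₗ R.subtype) := fun y =>
      ⟨⟨_, ⟨fderiv ℝ e.symm z (y, 0), rfl⟩⟩, hid' (y, 0)⟩
    have hinjR : Function.Injective (P.toLinearMap ∘ₗ R.subtype) :=
      (LinearMap.injective_iff_surjective_of_finrank_eq_finrank
        (by rw [finrank_euclideanSpace_fin]; exact hrz)).2 hsurj
    have := @hinjR ⟨_, ⟨fderiv ℝ e.symm z (0, k), rfl⟩⟩ 0 (by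
      rw [map_zero]; exact hid' (0, k))
    exact congrArg Subtype.val this
  obtain ⟨ε, hε, hball⟩ := Metric.eventually_nhds_iff_ball.1 hzero
  refine ⟨fun x => P (F x), fun y => Φ (y, K.orthogonalProjectionOnto x₀),
    P.contDiff.contDiffAt.comp x₀ hF, ?_, ?_⟩
  · exact ContDiffAt.comp (g := Φ) (P (F x₀)) hΦ (contDiffAt_id.prodMk contDiffAt_const)
  · filter_upwards [e.open_source.mem_nhds hes,
      hG.continuousAt.eventually (Metric.ball_mem_nhds _ hε)] with x hxs hx
    have h1 : F x = Φ (G x) := by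
      change F x = F (e.symm (e x))
      rw [e.left_inv hxs]
    have hx2 : P (F x) ∈ Metric.ball (P (F x₀)) ε ∧
        K.orthogonalProjectionOnto x ∈ Metric.ball (K.orthogonalProjectionOnto x₀) ε := by
      have h : G x ∈ Metric.ball (G x₀) ε := hx
      rwa [← ball_prod_same] at h
    have hd : ∀ k ∈ Metric.ball (K.orthogonalProjectionOnto x₀) ε,
        HasFDerivAt (fun k => Φ (P (F x), k)) (0 : K →L[ℝ] E N) k := by
      intro k hk
      obtain ⟨h2, h3⟩ := hball (P (F x), k) (by rw [← ball_prod_same]; exact ⟨hx2.1, hk⟩)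
      have h4 := h2.hasFDerivAt.comp k ((hasFDerivAt_const (P (F x)) k).prodMk (hasFDerivAt_id k))
      refine h4.congr_fderiv ?_
      ext1 v
      exact h3 v
    have hconst := (convex_ball (K.orthogonalProjectionOnto x₀) ε).is_const_of_fderivWithin_eq_zero
      (𝕜 := ℝ) (f := fun k => Φ (P (F x), k))
      (fun k hk => (hd k hk).differentiableAt.differentiableWithinAt)
      (fun k hk => (hd k hk).hasFDerivWithinAt.fderivWithin
        (Metric.isOpen_ball.uniqueDiffWithinAt hk)) hx2.2 (Metric.mem_ball_self hε)
    rw [h1]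
    exact hconst

/-- A smooth map into an embedded submanifold factors smoothly through each parametrization. -/
theorem IsLocalParam.exists_lift {S : Set (E N)} {U : Set (E d)} {ψ : E d → E N}
    (hψ : IsLocalParam S U ψ) {y₀ : E d} (hy₀ : y₀ ∈ U) {F : E n → E N} {x₀ : E n}
    (hF : ContDiffAt ℝ 2 F x₀) (h0 : F x₀ = ψ y₀) (hFS : ∀ᶠ x in 𝓝 x₀, F x ∈ S) :
    ∃ π : E n → E d, ContDiffAt ℝ 2 π x₀ ∧ π x₀ = y₀ ∧ F =ᶠ[𝓝 x₀] ψ ∘ π := by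
  have hψd : ContDiffAt ℝ 2 ψ y₀ :=
    (hψ.smooth.contDiffAt (hψ.isOpen.mem_nhds hy₀)).of_le two_le_infty
  obtain ⟨L, hL⟩ := (fderiv ℝ ψ y₀).toLinearMap.exists_leftInverse_of_injective
    (LinearMap.ker_eq_bot.2 (hψ.immersion y₀ hy₀))
  let P : E N →L[ℝ] E d := L.toContinuousLinearMap
  have hPψ : ContDiffAt ℝ 2 (P ∘ ψ) y₀ := P.contDiff.contDiffAt.comp y₀ hψd
  have hder : HasFDerivAt (P ∘ ψ) (ContinuousLinearEquiv.refl ℝ (E d) : E d →L[ℝ] E d) y₀ := by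
    refine (P.hasFDerivAt.comp y₀ (hψd.differentiableAt (by simp)).hasFDerivAt).congr_fderiv ?_
    ext1 v
    exact congrArg (fun M => M v) hL
  let e := hPψ.toOpenPartialHomeomorph _ hder (by simp)
  have hes : y₀ ∈ e.source := hPψ.mem_toOpenPartialHomeomorph_source hder (by simp)
  have hsymm : ContDiffAt ℝ 2 e.symm (P (ψ y₀)) := hPψ.to_localInverse hder (by simp)
  have hex : e.symm (P (ψ y₀)) = y₀ := e.left_inv hes
  -- Relative openness of this patch keeps `F x` inside it for `x` near `x₀`; there ψ is inverted by
  -- `e.symm ∘ P`.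
  obtain ⟨W, hW, hWeq⟩ := hψ.image_open (U ∩ e.source) Set.inter_subset_left
    (hψ.isOpen.inter e.open_source)
  have hmem : F x₀ ∈ W := by
    have : ψ y₀ ∈ ψ '' (U ∩ e.source) := ⟨y₀, ⟨hy₀, hes⟩, rfl⟩
    rw [hWeq, ← h0] at this
    exact this.2
  refine ⟨fun x => e.symm (P (F x)), ?_, by simp only [h0, hex], ?_⟩
  · rw [← h0] at hsymm
    exact ContDiffAt.comp x₀ hsymm (P.contDiff.contDiffAt.comp x₀ hF)
  · filter_upwards [hFS, hF.continuousAt.eventually (hW.mem_nhds hmem)] with x hxS hxW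
    obtain ⟨y, hy, hyx⟩ : F x ∈ ψ '' (U ∩ e.source) := by rw [hWeq]; exact ⟨hxS, hxW⟩
    have : e.symm (P (F x)) = y := by rw [← hyx]; exact e.left_inv hy.2
    change F x = ψ (e.symm (P (F x)))
    rw [this, hyx]

end RankTheorem

/-! ### Principal charts, parallel maps and focal factorizations -/

section FocalAnalysis

open Filter Topology

variable {n d : ℕ} {ι : Type*}

/-- A chart `φ` of a hypersurface of the unit sphere with unit normal `N` along `φ`, whose principal
curvatures are the constants `κ k`, with multiplicities `m k`. -/
structure IsPrincipalChart (U : Set (E n)) (φ N : E n → E (n + 2)) (κ : ι → ℝ) (m : ι → ℕ) :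
    Prop where
  isOpen : IsOpen U
  smooth : ContDiffOn ℝ ∞ φ U
  smooth_normal : ContDiffOn ℝ ∞ N U
  immersion : ∀ x ∈ U, Function.Injective (fderiv ℝ φ x)
  norm_eq_one : ∀ x ∈ U, ‖φ x‖ = 1
  norm_normal : ∀ x ∈ U, ‖N x‖ = 1
  orthogonal : ∀ x ∈ U, inner ℝ (φ x) (N x) = 0
  normal : ∀ x ∈ U, ∀ v, inner ℝ (N x) (fderiv ℝ φ x v) = 0
  iSup_ker : ∀ x ∈ U, ⨆ k, LinearMap.ker (fderiv ℝ N x + κ k • fderiv ℝ φ x).toLinearMap = ⊤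
  finrank_ker : ∀ x ∈ U, ∀ k,
    Module.finrank ℝ (LinearMap.ker (fderiv ℝ N x + κ k • fderiv ℝ φ x).toLinearMap) = m k
  mult_pos : ∀ k, 0 < m k
  eq_curvature : ∀ x ∈ U, ∀ r, ∀ v ≠ 0, fderiv ℝ N x v + r • fderiv ℝ φ x v = 0 → ∃ k, r = κ k

/-- The parallel map at distance `t`. -/
def parallelMap (t : ℝ) (φ N : E n → E (n + 2)) (x : E n) : E (n + 2) :=
  Real.cos t • φ x + Real.sin t • N x

/-- The unit normal at the parallel map at distance `t`. -/
def parallelNormal (t : ℝ) (φ N : E n → E (n + 2)) (x : E n) : E (n + 2) :=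
  -Real.sin t • φ x + Real.cos t • N x

namespace IsPrincipalChart

variable {U : Set (E n)} {φ N : E n → E (n + 2)} {κ : ι → ℝ} {m : ι → ℕ} {x : E n}
  {j : ι} {t : ℝ}

theorem differentiableAt (h : IsPrincipalChart U φ N κ m) (hx : x ∈ U) : DifferentiableAt ℝ φ x :=
  (h.smooth.contDiffAt (h.isOpen.mem_nhds hx)).differentiableAt (by simp)

theorem differentiableAt_normal (h : IsPrincipalChart U φ N κ m) (hx : x ∈ U) :
    DifferentiableAt ℝ N x :=
  (h.smooth_normal.contDiffAt (h.isOpen.mem_nhds hx)).differentiableAt (by simp)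

theorem fderiv_parallelMap (h : IsPrincipalChart U φ N κ m) (hx : x ∈ U) (v : E n) :
    fderiv ℝ (parallelMap t φ N) x v =
      Real.cos t • fderiv ℝ φ x v + Real.sin t • fderiv ℝ N x v := by
  have := ((h.differentiableAt hx).hasFDerivAt.const_smul (Real.cos t)).add
    ((h.differentiableAt_normal hx).hasFDerivAt.const_smul (Real.sin t))
  rw [show parallelMap t φ N = Real.cos t • φ + Real.sin t • N from rfl, this.fderiv]
  rfl

theorem fderiv_parallelNormal (h : IsPrincipalChart U φ N κ m) (hx : x ∈ U) (v : E n) :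
    fderiv ℝ (parallelNormal t φ N) x v =
      -Real.sin t • fderiv ℝ φ x v + Real.cos t • fderiv ℝ N x v := by
  have := ((h.differentiableAt hx).hasFDerivAt.const_smul (-Real.sin t)).add
    ((h.differentiableAt_normal hx).hasFDerivAt.const_smul (Real.cos t))
  rw [show parallelNormal t φ N = -Real.sin t • φ + Real.cos t • N from rfl, this.fderiv]
  rfl

theorem contDiffAt_parallelMap (h : IsPrincipalChart U φ N κ m) (hx : x ∈ U) :
    ContDiffAt ℝ 2 (parallelMap t φ N) x :=
  (((h.smooth.contDiffAt (h.isOpen.mem_nhds hx)).const_smul (Real.cos t)).add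
    ((h.smooth_normal.contDiffAt (h.isOpen.mem_nhds hx)).const_smul (Real.sin t))).of_le
    two_le_infty

theorem contDiffAt_parallelNormal (h : IsPrincipalChart U φ N κ m) (hx : x ∈ U) :
    ContDiffAt ℝ 2 (parallelNormal t φ N) x :=
  (((h.smooth.contDiffAt (h.isOpen.mem_nhds hx)).const_smul (-Real.sin t)).add
    ((h.smooth_normal.contDiffAt (h.isOpen.mem_nhds hx)).const_smul (Real.cos t))).of_le
    two_le_infty

theorem inner_fderiv (h : IsPrincipalChart U φ N κ m) (hx : x ∈ U) (v : E n) :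
    inner ℝ (fderiv ℝ φ x v) (φ x) = 0 :=
  inner_fderiv_self_eq_zero (h.differentiableAt hx)
    (by filter_upwards [h.isOpen.mem_nhds hx] with z hz using h.norm_eq_one z hz) v

theorem inner_fderiv_normal (h : IsPrincipalChart U φ N κ m) (hx : x ∈ U) (v : E n) :
    inner ℝ (fderiv ℝ N x v) (N x) = 0 :=
  inner_fderiv_self_eq_zero (h.differentiableAt_normal hx)
    (by filter_upwards [h.isOpen.mem_nhds hx] with z hz using h.norm_normal z hz) v

theorem inner_fderiv_normal_chart (h : IsPrincipalChart U φ N κ m) (hx : x ∈ U) (v : E n) :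
    inner ℝ (fderiv ℝ N x v) (φ x) = 0 := by
  have := inner_fderiv_add_eq_zero (h.differentiableAt hx) (h.differentiableAt_normal hx)
    (by filter_upwards [h.isOpen.mem_nhds hx] with z hz using h.orthogonal z hz) v
  rw [real_inner_comm _ (fderiv ℝ φ x v), h.normal x hx, add_zero, real_inner_comm] at this
  exact this

theorem inner_fderiv_chart_normal (h : IsPrincipalChart U φ N κ m) (hx : x ∈ U) (v : E n) :
    inner ℝ (fderiv ℝ φ x v) (N x) = 0 := by
  rw [real_inner_comm]; exact h.normal x hx v

theorem inner_fderiv_parallelNormal (h : IsPrincipalChart U φ N κ m) (hx : x ∈ U) (s : ℝ)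
    (v : E n) : inner ℝ (fderiv ℝ (parallelMap t φ N) x v) (parallelNormal s φ N x) = 0 := by
  rw [h.fderiv_parallelMap hx, parallelNormal]
  simp only [inner_add_left, inner_add_right, inner_smul_left, inner_smul_right,
    h.inner_fderiv hx, h.inner_fderiv_normal hx, h.inner_fderiv_normal_chart hx,
    h.inner_fderiv_chart_normal hx]
  simp

theorem inner_fderiv_parallelMap_self (h : IsPrincipalChart U φ N κ m) (hx : x ∈ U)
    (v : E n) : inner ℝ (fderiv ℝ (parallelNormal t φ N) x v) (parallelMap t φ N x) = 0 := by
  rw [h.fderiv_parallelNormal hx, parallelMap]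
  simp only [inner_add_left, inner_add_right, inner_smul_left, inner_smul_right,
    h.inner_fderiv hx, h.inner_fderiv_normal hx, h.inner_fderiv_normal_chart hx,
    h.inner_fderiv_chart_normal hx]
  simp

theorem inner_fderiv_parallelNormal_self (h : IsPrincipalChart U φ N κ m) (hx : x ∈ U)
    (v : E n) : inner ℝ (fderiv ℝ (parallelNormal t φ N) x v) (parallelNormal t φ N x) = 0 := by
  rw [h.fderiv_parallelNormal hx, parallelNormal]
  simp only [inner_add_left, inner_add_right, inner_smul_left, inner_smul_right,
    h.inner_fderiv hx, h.inner_fderiv_normal hx, h.inner_fderiv_normal_chart hx,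
    h.inner_fderiv_chart_normal hx]
  simp

theorem inner_parallelMap_parallelNormal (h : IsPrincipalChart U φ N κ m) (hx : x ∈ U) :
    inner ℝ (parallelMap t φ N x) (parallelNormal t φ N x) = 0 := by
  rw [parallelMap, parallelNormal]
  simp only [inner_add_left, inner_add_right, inner_smul_left, inner_smul_right,
    h.orthogonal x hx, real_inner_comm (φ x) (N x), real_inner_self_eq_norm_sq,
    h.norm_eq_one x hx, h.norm_normal x hx]
  simp
  ring

theorem norm_parallelNormal (h : IsPrincipalChart U φ N κ m) (hx : x ∈ U) :
    ‖parallelNormal t φ N x‖ = 1 := by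
  have : ‖parallelNormal t φ N x‖ ^ 2 = 1 := by
    rw [← real_inner_self_eq_norm_sq, parallelNormal]
    simp only [inner_add_left, inner_add_right, inner_smul_left, inner_smul_right,
      h.orthogonal x hx, real_inner_comm (φ x) (N x), real_inner_self_eq_norm_sq,
      h.norm_eq_one x hx, h.norm_normal x hx]
    simp
    nlinarith [Real.sin_sq_add_cos_sq t]
  nlinarith [norm_nonneg (parallelNormal t φ N x)]

theorem norm_parallelMap (h : IsPrincipalChart U φ N κ m) (hx : x ∈ U) :
    ‖parallelMap t φ N x‖ = 1 := by
  have : ‖parallelMap t φ N x‖ ^ 2 = 1 := by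
    rw [← real_inner_self_eq_norm_sq, parallelMap]
    simp only [inner_add_left, inner_add_right, inner_smul_left, inner_smul_right,
      h.orthogonal x hx, real_inner_comm (φ x) (N x), real_inner_self_eq_norm_sq,
      h.norm_eq_one x hx, h.norm_normal x hx]
    simp
    nlinarith [Real.sin_sq_add_cos_sq t]
  nlinarith [norm_nonneg (parallelMap t φ N x)]

/-- When cot t = κ_j, the differential of the parallel map is sin t (dN + κ_j dφ), so exactly the
principal directions of κ_j collapse. -/
theorem ker_fderiv_parallelMap (h : IsPrincipalChart U φ N κ m) (hx : x ∈ U)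
    (hs : Real.sin t ≠ 0) (hc : Real.cos t = κ j * Real.sin t) :
    LinearMap.ker (fderiv ℝ (parallelMap t φ N) x).toLinearMap =
      LinearMap.ker (fderiv ℝ N x + κ j • fderiv ℝ φ x).toLinearMap := by
  ext v
  have : fderiv ℝ (parallelMap t φ N) x v =
      Real.sin t • (fderiv ℝ N x v + κ j • fderiv ℝ φ x v) := by
    rw [h.fderiv_parallelMap hx, hc]; module
  simp only [LinearMap.mem_ker, ContinuousLinearMap.coe_coe, this, smul_eq_zero, hs, false_or]
  rfl

theorem finrank_range_fderiv_parallelMap (h : IsPrincipalChart U φ N κ m) (hx : x ∈ U)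
    (hs : Real.sin t ≠ 0) (hc : Real.cos t = κ j * Real.sin t) :
    Module.finrank ℝ (LinearMap.range (fderiv ℝ (parallelMap t φ N) x).toLinearMap) + m j = n := by
  have := LinearMap.finrank_range_add_finrank_ker (fderiv ℝ (parallelMap t φ N) x).toLinearMap
  rwa [h.ker_fderiv_parallelMap hx hs hc, h.finrank_ker x hx, finrank_euclideanSpace_fin] at this

theorem fderiv_parallelMap_of_mem (h : IsPrincipalChart U φ N κ m) (hx : x ∈ U)
    (hc : Real.cos t = κ j * Real.sin t) {k : ι} {w : E n}
    (hw : w ∈ LinearMap.ker (fderiv ℝ N x + κ k • fderiv ℝ φ x).toLinearMap) :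
    fderiv ℝ (parallelMap t φ N) x w = (Real.sin t * (κ j - κ k)) • fderiv ℝ φ x w := by
  have hw' : fderiv ℝ N x w = -(κ k • fderiv ℝ φ x w) := eq_neg_of_add_eq_zero_left hw
  rw [h.fderiv_parallelMap hx, hw', hc]; module

theorem fderiv_parallelNormal_of_mem (h : IsPrincipalChart U φ N κ m) (hx : x ∈ U)
    (hc : Real.cos t = κ j * Real.sin t) {k : ι} {w : E n}
    (hw : w ∈ LinearMap.ker (fderiv ℝ N x + κ k • fderiv ℝ φ x).toLinearMap) :
    fderiv ℝ (parallelNormal t φ N) x w = -(Real.sin t * (1 + κ j * κ k)) • fderiv ℝ φ x w := by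
  have hw' : fderiv ℝ N x w = -(κ k • fderiv ℝ φ x w) := eq_neg_of_add_eq_zero_left hw
  rw [h.fderiv_parallelNormal hx, hw', hc]; module

end IsPrincipalChart

/-- The principal curvature of the focal manifold of `κ j` that comes from `κ k`. -/
def focalCurvature (κ : ι → ℝ) (j k : ι) : ℝ := (1 + κ j * κ k) / (κ j - κ k)

/-- The parallel map that collapses the leaves of the principal curvature `κ j`, factored near `x₀`
as `ψ ∘ π` through a space of dimension equal to its rank. -/
structure IsFocalFactorization (U : Set (E n)) (φ N : E n → E (n + 2)) (κ : ι → ℝ) (m : ι → ℕ)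
    (j : ι) (t : ℝ) (x₀ : E n) (π : E n → E d) (ψ : E d → E (n + 2)) : Prop where
  chart : IsPrincipalChart U φ N κ m
  injective : Function.Injective κ
  mem : x₀ ∈ U
  sin_ne_zero : Real.sin t ≠ 0
  cos_eq : Real.cos t = κ j * Real.sin t
  contDiffAt_proj : ContDiffAt ℝ 2 π x₀
  contDiffAt_map : ContDiffAt ℝ 2 ψ (π x₀)
  eventuallyEq : parallelMap t φ N =ᶠ[𝓝 x₀] ψ ∘ π
  dim_add : d + m j = n

/-- The properties of a focal factorization at a point near the base point. -/
structure IsRegularPoint (U : Set (E n)) (φ N : E n → E (n + 2)) (t : ℝ)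
    (π : E n → E d) (ψ : E d → E (n + 2)) (x : E n) : Prop where
  mem : x ∈ U
  eq : parallelMap t φ N x = ψ (π x)
  fderiv_eq : ∀ v, fderiv ℝ (parallelMap t φ N) x v = fderiv ℝ ψ (π x) (fderiv ℝ π x v)
  injective : Function.Injective (fderiv ℝ ψ (π x))
  surjective : Function.Surjective (fderiv ℝ π x)
  symm : ∀ a b, fderiv ℝ (fderiv ℝ ψ) (π x) a b = fderiv ℝ (fderiv ℝ ψ) (π x) b a
  contDiffAt : ContDiffAt ℝ 2 ψ (π x)
  orthogonal : ∀ b, inner ℝ (fderiv ℝ ψ (π x) b) (parallelNormal t φ N x) = 0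
  second : ∀ w b, inner ℝ (fderiv ℝ (fderiv ℝ ψ) (π x) (fderiv ℝ π x w) b)
    (parallelNormal t φ N x) = - inner ℝ (fderiv ℝ ψ (π x) b)
      (fderiv ℝ (parallelNormal t φ N) x w)

/-! ### Generalized eigenvectors of the second fundamental form -/

section NormalForm

variable {M : ℕ} {ψ : E d → E M} {y : E d}

theorem normalForm_mulVec (hψ : ContDiffAt ℝ 2 ψ y) (α : E M) (b : E d) (i : Fin d) :
    (normalForm ψ y α).mulVec b i =
      inner ℝ (fderiv ℝ (fderiv ℝ ψ) y (EuclideanSpace.single i 1) b) α := by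
  simp only [Matrix.mulVec, dotProduct, normalForm, Matrix.of_apply, partialDeriv_partialDeriv hψ]
  conv_rhs => rw [← (EuclideanSpace.basisFun (Fin d) ℝ).sum_repr b]
  simp [sum_inner, inner_smul_left, mul_comm]

theorem inducedMetric_mulVec (ψ : E d → E M) (y b : E d) (i : Fin d) :
    (inducedMetric ψ y).mulVec b i =
      inner ℝ (fderiv ℝ ψ y (EuclideanSpace.single i 1)) (fderiv ℝ ψ y b) := by
  rw [fderiv_eq_sum_partialDeriv ψ y b, inner_sum]
  simp only [Matrix.mulVec, dotProduct, inducedMetric, Matrix.of_apply, inner_smul_right]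
  exact Finset.sum_congr rfl fun j _ => mul_comm _ _

theorem normalForm_mulVec_eq_iff (hψ : ContDiffAt ℝ 2 ψ y) (α : E M) (b : E d) (c : ℝ) :
    (normalForm ψ y α).mulVec b = c • (inducedMetric ψ y).mulVec b ↔
      ∀ a, inner ℝ (fderiv ℝ (fderiv ℝ ψ) y a b) α =
        c * inner ℝ (fderiv ℝ ψ y a) (fderiv ℝ ψ y b) := by
  constructor
  · intro h a
    conv_lhs => rw [← (EuclideanSpace.basisFun (Fin d) ℝ).sum_repr a]
    conv_rhs => rw [← (EuclideanSpace.basisFun (Fin d) ℝ).sum_repr a]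
    simp only [map_sum, map_smul, _root_.sum_apply, _root_.smul_apply,
      sum_inner, inner_smul_left, Finset.mul_sum]
    refine Finset.sum_congr rfl fun i _ => ?_
    have := congrFun h i
    rw [normalForm_mulVec hψ, Pi.smul_apply, inducedMetric_mulVec] at this
    rw [EuclideanSpace.basisFun_apply, this, smul_eq_mul]
    ring
  · intro h
    ext i
    rw [normalForm_mulVec hψ, Pi.smul_apply, inducedMetric_mulVec, h, smul_eq_mul]

end NormalForm

/-! ### Shape operator of the focal map in the direction of the parallel normal -/

namespace IsFocalFactorization

variable {U : Set (E n)} {φ N : E n → E (n + 2)} {κ : ι → ℝ} {m : ι → ℕ}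
  {j : ι} {t : ℝ} {x₀ : E n} {π : E n → E d} {ψ : E d → E (n + 2)}

theorem eventually_isRegularPoint (h : IsFocalFactorization U φ N κ m j t x₀ π ψ) :
    ∀ᶠ x in 𝓝 x₀, IsRegularPoint U φ N t π ψ x := by
  have hU : ∀ᶠ x in 𝓝 x₀, x ∈ U := h.chart.isOpen.mem_nhds h.mem
  have hπ : ∀ᶠ x in 𝓝 x₀, DifferentiableAt ℝ π x :=
    (h.contDiffAt_proj.eventually (by simp)).mono fun x hx => hx.differentiableAt (by simp)
  have hψ : ∀ᶠ x in 𝓝 x₀, ContDiffAt ℝ 2 ψ (π x) :=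
    h.contDiffAt_proj.continuousAt.eventually (h.contDiffAt_map.eventually (by simp))
  have hfd : ∀ᶠ x in 𝓝 x₀, ∀ v,
      fderiv ℝ (parallelMap t φ N) x v = fderiv ℝ ψ (π x) (fderiv ℝ π x v) := by
    filter_upwards [h.eventuallyEq.eventuallyEq_nhds, hπ, hψ] with x h1 h2 h3 v
    rw [h1.fderiv_eq, fderiv_comp x (h3.differentiableAt (by simp)) h2]
    rfl
  -- The composite has rank d, and both factors have rank at most d, so both have rank exactly d.
  have hinj : ∀ᶠ x in 𝓝 x₀, Function.Injective (fderiv ℝ ψ (π x)) ∧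
      Function.Surjective (fderiv ℝ π x) := by
    filter_upwards [hU, hfd] with x hx hv
    have h1 := h.chart.finrank_range_fderiv_parallelMap hx h.sin_ne_zero h.cos_eq
    have h2 : (fderiv ℝ (parallelMap t φ N) x).toLinearMap =
        (fderiv ℝ ψ (π x)).toLinearMap ∘ₗ (fderiv ℝ π x).toLinearMap := LinearMap.ext hv
    have h3 : Module.finrank ℝ (LinearMap.range (fderiv ℝ (parallelMap t φ N) x).toLinearMap) = d :=
      by have := h.dim_add; omega
    rw [h2] at h3
    have h4 : Module.finrank ℝ (LinearMap.range (fderiv ℝ ψ (π x)).toLinearMap) = d := by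
      refine le_antisymm ?_ ?_
      · simpa using LinearMap.finrank_range_le (fderiv ℝ ψ (π x)).toLinearMap
      · exact h3.symm.le.trans (Submodule.finrank_mono (LinearMap.range_comp_le_range _ _))
    have h5 : Module.finrank ℝ (LinearMap.range (fderiv ℝ π x).toLinearMap) = d := by
      refine le_antisymm ?_ ?_
      · simpa using Submodule.finrank_le (LinearMap.range (fderiv ℝ π x).toLinearMap)
      · rw [LinearMap.range_comp] at h3
        exact h3.symm.le.trans (Submodule.finrank_map_le _ _)
    refine ⟨?_, ?_⟩
    · have h6 := LinearMap.finrank_range_add_finrank_ker (fderiv ℝ ψ (π x)).toLinearMap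
      rw [h4, finrank_euclideanSpace_fin] at h6
      have h7 := Submodule.finrank_eq_zero.1 (Nat.add_left_cancel (h6.trans (add_zero d).symm))
      exact LinearMap.ker_eq_bot.1 h7
    · exact LinearMap.range_eq_top.1 (Submodule.eq_top_of_finrank_eq
        (h5.trans finrank_euclideanSpace_fin.symm))
  have horth : ∀ᶠ x in 𝓝 x₀, ∀ b,
      inner ℝ (fderiv ℝ ψ (π x) b) (parallelNormal t φ N x) = 0 := by
    filter_upwards [hU, hfd, hinj] with x hx hv hi b
    obtain ⟨w, rfl⟩ := hi.2 b
    rw [← hv]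
    exact h.chart.inner_fderiv_parallelNormal hx _ _
  filter_upwards [hU, hπ, hψ, hfd, hinj, horth, eventually_eventually_nhds.2 horth,
    h.eventuallyEq] with x hx hp hs hv hi ho ho' he
  refine ⟨hx, he, hv, hi.1, hi.2, fun a b => (hs.isSymmSndFDerivAt (by simp)) a b, hs, ho,
    fun w b => ?_⟩
  have hd2 : DifferentiableAt ℝ (fderiv ℝ ψ) (π x) :=
    (hs.fderiv_right (m := 1) (by norm_num)).differentiableAt (by norm_num)
  have hd3 : HasFDerivAt (fun z => fderiv ℝ ψ (π z) b)
      ((ContinuousLinearMap.apply ℝ _ b) ∘L (fderiv ℝ (fderiv ℝ ψ) (π x)) ∘L fderiv ℝ π x) x :=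
    ((ContinuousLinearMap.apply ℝ (E (n + 2)) b).hasFDerivAt).comp x
      (hd2.hasFDerivAt.comp x hp.hasFDerivAt)
  -- Differentiate the orthogonality ⟨dψ(b), η⟩ = 0 along `w`, with `b` fixed.
  have := inner_fderiv_add_eq_zero hd3.differentiableAt
    ((h.chart.contDiffAt_parallelNormal (t := t) hx).differentiableAt (by simp))
    (ho'.mono fun z hz => hz b) w
  rw [hd3.fderiv] at this
  exact eq_neg_of_add_eq_zero_right this

theorem isRegularPoint (h : IsFocalFactorization U φ N κ m j t x₀ π ψ) :
    IsRegularPoint U φ N t π ψ x₀ := h.eventually_isRegularPoint.self_of_nhds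

/-- On a principal direction of κ_k both the parallel map and its normal have differential a
multiple of dφ(w); minus the quotient of the two factors is the focal curvature. -/
theorem second_eq (h : IsFocalFactorization U φ N κ m j t x₀ π ψ) {x : E n}
    (hx : IsRegularPoint U φ N t π ψ x) {k : ι} (hk : k ≠ j) {w : E n}
    (hw : w ∈ LinearMap.ker (fderiv ℝ N x + κ k • fderiv ℝ φ x).toLinearMap) (a : E d) :
    inner ℝ (fderiv ℝ (fderiv ℝ ψ) (π x) a (fderiv ℝ π x w)) (parallelNormal t φ N x) =
      focalCurvature κ j k *
        inner ℝ (fderiv ℝ ψ (π x) a) (fderiv ℝ ψ (π x) (fderiv ℝ π x w)) := by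
  have hne : κ j - κ k ≠ 0 := sub_ne_zero.2 fun e => hk (h.injective e).symm
  rw [hx.symm, hx.second, ← hx.fderiv_eq, h.chart.fderiv_parallelMap_of_mem hx.mem h.cos_eq hw,
    h.chart.fderiv_parallelNormal_of_mem hx.mem h.cos_eq hw, inner_smul_right, inner_smul_right,
    focalCurvature]
  field_simp

theorem fderiv_proj_eq_zero (h : IsFocalFactorization U φ N κ m j t x₀ π ψ) {x : E n}
    (hx : IsRegularPoint U φ N t π ψ x) {w : E n}
    (hw : w ∈ LinearMap.ker (fderiv ℝ N x + κ j • fderiv ℝ φ x).toLinearMap) :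
    fderiv ℝ π x w = 0 := by
  rw [← h.chart.ker_fderiv_parallelMap hx.mem h.sin_ne_zero h.cos_eq] at hw
  apply hx.injective
  rw [map_zero, ← hx.fderiv_eq]
  exact hw

/-- The images under dπ of the principal directions with k ≠ j span the tangent space, because dπ is
onto and kills those of κ_j. -/
theorem span_induction (h : IsFocalFactorization U φ N κ m j t x₀ π ψ) {x : E n}
    (hx : IsRegularPoint U φ N t π ψ x) {p : E d → Prop} (h0 : p 0)
    (hadd : ∀ a b, p a → p b → p (a + b))
    (hp : ∀ k ≠ j, ∀ w ∈ LinearMap.ker (fderiv ℝ N x + κ k • fderiv ℝ φ x).toLinearMap,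
      p (fderiv ℝ π x w)) (b : E d) : p b := by
  obtain ⟨w, rfl⟩ := hx.surjective b
  have hw : w ∈ ⨆ k, LinearMap.ker (fderiv ℝ N x + κ k • fderiv ℝ φ x).toLinearMap := by
    rw [h.chart.iSup_ker x hx.mem]; trivial
  refine Submodule.iSup_induction _ (motive := fun w => p (fderiv ℝ π x w)) hw ?_ ?_ ?_
  · intro k w hw
    by_cases hk : k = j
    · subst hk
      rwa [h.fderiv_proj_eq_zero hx hw]
    · exact hp k hk w hw
  · rwa [map_zero]
  · intro a b ha hb
    rw [map_add]
    exact hadd _ _ ha hb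

theorem det_normalForm_sub (h : IsFocalFactorization U φ N κ m j t x₀ π ψ) {x : E n}
    (hx : IsRegularPoint U φ N t π ψ x) {k : ι} (hk : k ≠ j) :
    (normalForm ψ (π x) (parallelNormal t φ N x) -
      focalCurvature κ j k • inducedMetric ψ (π x)).det = 0 := by
  have hpos : 0 < Module.finrank ℝ
      (LinearMap.ker (fderiv ℝ N x + κ k • fderiv ℝ φ x).toLinearMap) := by
    rw [h.chart.finrank_ker x hx.mem]; exact h.chart.mult_pos k
  obtain ⟨⟨w, hw⟩, hw0⟩ := Module.finrank_pos_iff_exists_ne_zero.1 hpos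
  have hw0' : w ≠ 0 := fun e => hw0 (Subtype.ext e)
  have hb : fderiv ℝ π x w ≠ 0 := by
    intro e
    have h1 := hx.fderiv_eq w
    rw [e, map_zero, h.chart.fderiv_parallelMap_of_mem hx.mem h.cos_eq hw, smul_eq_zero,
      mul_eq_zero, sub_eq_zero] at h1
    rcases h1 with (h1 | h1) | h1
    · exact h.sin_ne_zero h1
    · exact hk (h.injective h1).symm
    · exact hw0' (h.chart.immersion x hx.mem (h1.trans (map_zero _).symm))
  refine Matrix.exists_mulVec_eq_zero_iff.1 ⟨(fderiv ℝ π x w).ofLp, by simpa using hb, ?_⟩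
  rw [Matrix.sub_mulVec, Matrix.smul_mulVec, sub_eq_zero,
    normalForm_mulVec_eq_iff hx.contDiffAt]
  exact h.second_eq hx hk hw

/-- Eigenvectors of a symmetric form for different eigenvalues are orthogonal. An eigenvector for
any other value would be orthogonal to a spanning set, hence zero. -/
theorem exists_focalCurvature_eq (h : IsFocalFactorization U φ N κ m j t x₀ π ψ) {x : E n}
    (hx : IsRegularPoint U φ N t π ψ x) {c : ℝ}
    (hc : (normalForm ψ (π x) (parallelNormal t φ N x) - c • inducedMetric ψ (π x)).det = 0) :
    ∃ k, k ≠ j ∧ focalCurvature κ j k = c := by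
  by_contra! hne
  obtain ⟨b, hb0, hb⟩ := Matrix.exists_mulVec_eq_zero_iff.2 hc
  have hb' := (normalForm_mulVec_eq_iff hx.contDiffAt (parallelNormal t φ N x) (WithLp.toLp 2 b) c).1
    (by rwa [Matrix.sub_mulVec, Matrix.smul_mulVec, sub_eq_zero] at hb)
  have hall : ∀ a, inner ℝ (fderiv ℝ ψ (π x) a) (fderiv ℝ ψ (π x) (WithLp.toLp 2 b)) = 0 := by
    refine h.span_induction hx (by simp) (fun a b ha hb => ?_) fun k hk w hw => ?_
    · rw [map_add, inner_add_left, ha, hb, add_zero]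
    · have h1 := h.second_eq hx hk hw (WithLp.toLp 2 b)
      rw [hx.symm, hb', real_inner_comm] at h1
      have h2 : (c - focalCurvature κ j k) * inner ℝ (fderiv ℝ ψ (π x) (WithLp.toLp 2 b))
          (fderiv ℝ ψ (π x) (fderiv ℝ π x w)) = 0 := by linarith
      rw [real_inner_comm]
      exact (mul_eq_zero.1 h2).resolve_left (sub_ne_zero.2 (hne k hk).symm)
  have h0 := inner_self_eq_zero.1 (hall (WithLp.toLp 2 b))
  have := hx.injective (h0.trans (map_zero _).symm)
  exact hb0 (by simpa using this)

theorem pow_three_eq (h : IsFocalFactorization U φ N κ m j t x₀ π ψ) {x : E n}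
    (hx : IsRegularPoint U φ N t π ψ x)
    (hc : ∀ k ≠ j, focalCurvature κ j k ^ 3 = focalCurvature κ j k) :
    ((inducedMetric ψ (π x))⁻¹ * normalForm ψ (π x) (parallelNormal t φ N x)) ^ 3 =
      (inducedMetric ψ (π x))⁻¹ * normalForm ψ (π x) (parallelNormal t φ N x) := by
  have hdet : IsUnit (inducedMetric ψ (π x)).det :=
    (posDef_inducedMetric hx.injective).det_pos.ne'.isUnit
  set A := (inducedMetric ψ (π x))⁻¹ * normalForm ψ (π x) (parallelNormal t φ N x) with hA
  have hall : ∀ b : E d, (A ^ 3).mulVec b.ofLp = A.mulVec b.ofLp := by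
    refine h.span_induction hx (by simp) (fun a b ha hb => ?_) fun k hk w hw => ?_
    · rw [WithLp.ofLp_add, Matrix.mulVec_add, Matrix.mulVec_add, ha, hb]
    · have h1 := (normalForm_mulVec_eq_iff hx.contDiffAt (parallelNormal t φ N x) _ _).2
        (h.second_eq hx hk hw)
      have h2 : A.mulVec (fderiv ℝ π x w).ofLp =
          focalCurvature κ j k • (fderiv ℝ π x w).ofLp := by
        rw [hA, ← Matrix.mulVec_mulVec, h1, Matrix.mulVec_smul, Matrix.mulVec_mulVec,
          Matrix.nonsing_inv_mul _ hdet, Matrix.one_mulVec]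
      rw [pow_succ, pow_two, ← Matrix.mulVec_mulVec, ← Matrix.mulVec_mulVec, h2,
        Matrix.mulVec_smul, h2, Matrix.mulVec_smul, Matrix.mulVec_smul, h2, smul_smul, smul_smul]
      congr 1
      refine Eq.trans ?_ (hc k hk)
      ring
  refine Matrix.toLin'.injective (LinearMap.ext fun v => ?_)
  exact hall (WithLp.toLp 2 v)

end IsFocalFactorization

/-! ### Algebra of the focal curvatures -/

section Algebra

theorem neg_closed_three {x y z : ℝ} (hxy : x ≠ y) (hxz : x ≠ z) (hyz : y ≠ z)
    (hx : x = -x ∨ y = -x ∨ z = -x) (hy : x = -y ∨ y = -y ∨ z = -y)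
    (hz : x = -z ∨ y = -z ∨ z = -z) :
    (x = 0 ∧ y = -z) ∨ (y = 0 ∧ x = -z) ∨ (z = 0 ∧ x = -y) := by
  grind

theorem focalCurvature_injective {ι : Type*} {κ : ι → ℝ} (hκ : Function.Injective κ) {j k l : ι}
    (hk : k ≠ j) (hl : l ≠ j) (h : focalCurvature κ j k = focalCurvature κ j l) : k = l := by
  have h1 : κ j - κ k ≠ 0 := sub_ne_zero.2 fun e => hk (hκ e).symm
  have h2 : κ j - κ l ≠ 0 := sub_ne_zero.2 fun e => hl (hκ e).symm
  rw [focalCurvature, focalCurvature, div_eq_div_iff h1 h2] at h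
  have h3 : (κ j ^ 2 + 1) * (κ k - κ l) = 0 := by linarith
  have h4 : κ j ^ 2 + 1 ≠ 0 := by positivity
  exact hκ (sub_eq_zero.1 ((mul_eq_zero.1 h3).resolve_left h4))

theorem focalCurvature_eq_zero_iff {ι : Type*} {κ : ι → ℝ} (hκ : Function.Injective κ) {j k : ι}
    (hk : k ≠ j) : focalCurvature κ j k = 0 ↔ κ j * κ k = -1 := by
  have h1 : κ j - κ k ≠ 0 := sub_ne_zero.2 fun e => hk (hκ e).symm
  rw [focalCurvature, div_eq_zero_iff, or_iff_left h1]
  constructor <;> intro h <;> linarith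

/-- Three distinct reals closed under negation are a, 0, -a. The vanishing one singles out a partner
of κ_i with product -1. -/
theorem focalCurvature_dichotomy {κ : Fin 4 → ℝ} (hκ : Function.Injective κ)
    {i p q r : Fin 4} (hp : p ≠ i) (hq : q ≠ i) (hr : r ≠ i) (hpq : p ≠ q) (hpr : p ≠ r)
    (hqr : q ≠ r) (hcov : ∀ l, l = i ∨ l = p ∨ l = q ∨ l = r)
    (hsym : ∀ k ≠ i, ∃ l, l ≠ i ∧ focalCurvature κ i l = -focalCurvature κ i k) :
    (κ i * κ p = -1 ∧ focalCurvature κ i q = -focalCurvature κ i r) ∨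
    (κ i * κ q = -1 ∧ focalCurvature κ i p = -focalCurvature κ i r) ∨
    (κ i * κ r = -1 ∧ focalCurvature κ i p = -focalCurvature κ i q) := by
  have hcl : ∀ k ≠ i, focalCurvature κ i p = -focalCurvature κ i k ∨
      focalCurvature κ i q = -focalCurvature κ i k ∨
      focalCurvature κ i r = -focalCurvature κ i k := by
    intro k hk
    obtain ⟨l, hl, hlk⟩ := hsym k hk
    rcases hcov l with rfl | rfl | rfl | rfl
    · exact absurd rfl hl
    · exact Or.inl hlk
    · exact Or.inr (Or.inl hlk)
    · exact Or.inr (Or.inr hlk)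
  simp only [← focalCurvature_eq_zero_iff hκ hp, ← focalCurvature_eq_zero_iff hκ hq,
    ← focalCurvature_eq_zero_iff hκ hr]
  exact neg_closed_three (fun e => hpq (focalCurvature_injective hκ hp hq e))
    (fun e => hpr (focalCurvature_injective hκ hp hr e))
    (fun e => hqr (focalCurvature_injective hκ hq hr e)) (hcl p hp) (hcl q hq) (hcl r hr)

/-- With κ = cot θ, focal curvatures are cot(θ_k - θ_j). Here θ_b differs from θ_k by π/2, so the
hypothesis says cot = tan, and the value is ±1. -/
theorem focalCurvature_pow_three_of_pairs {κ : Fin 4 → ℝ} (hκ : Function.Injective κ)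
    {j k b : Fin 4} (hkj : k ≠ j) (hbj : b ≠ j) (hkb : κ k * κ b = -1)
    (h : focalCurvature κ j k = -focalCurvature κ j b) :
    focalCurvature κ j k ^ 3 = focalCurvature κ j k := by
  have h1 : κ j - κ k ≠ 0 := sub_ne_zero.2 fun e => hkj (hκ e).symm
  have h2 : κ j - κ b ≠ 0 := sub_ne_zero.2 fun e => hbj (hκ e).symm
  rw [focalCurvature, focalCurvature, ← neg_div, div_eq_div_iff h1 h2] at h
  have h3 : (1 + κ j * κ k) ^ 2 = (κ j - κ k) ^ 2 := by
    -- Multiplying the cross-multiplied equation by κ_k and putting κ_k κ_b = -1 turns both sides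
    -- into squares.
    linear_combination κ k * h + (1 + κ j * κ k - κ j * (κ j - κ k)) * hkb
  have h4 : focalCurvature κ j k ^ 2 = 1 := by
    rw [focalCurvature, div_pow, h3, div_self (pow_ne_zero 2 h1)]
  rw [pow_succ, h4, one_mul]

/-- If the principal curvatures of each focal manifold of a hypersurface with four principal
curvatures are symmetric about `0`, then they are `-1`, `0` and `1`. -/
theorem focalCurvature_pow_three {κ : Fin 4 → ℝ} (hκ : Function.Injective κ)
    (hsym : ∀ j, ∀ k ≠ j, ∃ l, l ≠ j ∧ focalCurvature κ j l = -focalCurvature κ j k)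
    {j k : Fin 4} (hk : k ≠ j) : focalCurvature κ j k ^ 3 = focalCurvature κ j k := by
  have hcov : ∀ j k : Fin 4, k ≠ j → ∃ a b, a ≠ j ∧ b ≠ j ∧ a ≠ k ∧ b ≠ k ∧ a ≠ b ∧
      ∀ l, l = j ∨ l = k ∨ l = a ∨ l = b := by decide
  have hpair : ∀ a b, a ≠ j → b ≠ j → a ≠ k → b ≠ k → a ≠ b →
      (∀ l, l = j ∨ l = k ∨ l = a ∨ l = b) → κ j * κ a = -1 →
      focalCurvature κ j k = -focalCurvature κ j b →
      focalCurvature κ j k ^ 3 = focalCurvature κ j k := by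
    intro a b haj hbj hak hbk hab hl hja hjk
    refine focalCurvature_pow_three_of_pairs hκ hk hbj ?_ hjk
    -- The symmetry at `k` gives κ_k a partner as well; it is neither `j` nor `a`, which are
    -- partners of each other, so it is `b`.
    rcases focalCurvature_dichotomy hκ (i := k) (p := j) (q := a) (r := b) hk.symm hak hbk haj.symm
      hbj.symm hab (fun l => by rcases hl l with h | h | h | h <;> tauto) (hsym k)
      with ⟨h, -⟩ | ⟨h, -⟩ | ⟨h, -⟩
    · have h0 : κ j ≠ 0 := by rintro e; rw [e, zero_mul] at hja; norm_num at hja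
      exact absurd (hκ (mul_left_cancel₀ h0 (by linarith : κ j * κ a = κ j * κ k))) hak
    · have h0 : κ a ≠ 0 := by rintro e; rw [e, mul_zero] at hja; norm_num at hja
      exact absurd (hκ (mul_right_cancel₀ h0 (by linarith : κ k * κ a = κ j * κ a))) hk
    · exact h
  obtain ⟨a, b, haj, hbj, hak, hbk, hab, hl⟩ := hcov j k hk
  rcases focalCurvature_dichotomy hκ hk haj hbj hak.symm hbk.symm hab hl (hsym j)
    with ⟨h, -⟩ | ⟨h, h'⟩ | ⟨h, h'⟩
  · rw [(focalCurvature_eq_zero_iff hκ hk).2 h]; norm_num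
  · exact hpair a b haj hbj hak hbk hab hl h h'
  · exact hpair b a hbj haj hbk hak hab.symm (fun l => by rcases hl l with h | h | h | h <;> tauto)
      h h'

/-- A is the difference of the idempotents (A² ± A)/2, and the trace of an idempotent is its rank.
-/
theorem exists_trace_eq_intCast {A : Matrix (Fin d) (Fin d) ℝ} (hA : A ^ 3 = A) :
    ∃ z : ℤ, A.trace = z := by
  have hidem : ∀ P : Matrix (Fin d) (Fin d) ℝ, P * P = P → ∃ k : ℕ, P.trace = k := by
    intro P hP
    have h1 : IsIdempotentElem (Matrix.toLin' P) := by
      rw [IsIdempotentElem, Module.End.mul_eq_comp, ← Matrix.toLin'_mul, hP]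
    refine ⟨Module.finrank ℝ (LinearMap.range (Matrix.toLin' P)), ?_⟩
    rw [← Matrix.trace_toLin'_eq, (LinearMap.IsIdempotentElem.isProj_range _ h1).trace]
  have h4 : A ^ 4 = A ^ 2 := by rw [pow_succ, hA, pow_two]
  have hhalf : ∀ ε : ℝ, ε ^ 2 = 1 → ((1 / 2 : ℝ) • (A ^ 2 + ε • A)) * ((1 / 2 : ℝ) • (A ^ 2 + ε • A)) =
      (1 / 2 : ℝ) • (A ^ 2 + ε • A) := by
    intro ε hε
    have e1 : A ^ 2 * A ^ 2 = A ^ 2 := by rw [← pow_add, h4]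
    have e2 : A ^ 2 * A = A := by rw [← pow_succ, hA]
    have e3 : A * A ^ 2 = A := by rw [← pow_succ', hA]
    rw [smul_mul_smul_comm, add_mul, mul_add, mul_add, e1, mul_smul_comm, e2, smul_mul_assoc, e3,
      smul_mul_smul_comm, ← pow_two A, ← pow_two ε, hε]
    module
  obtain ⟨a, ha⟩ := hidem _ (hhalf 1 (by norm_num))
  obtain ⟨b, hb⟩ := hidem _ (hhalf (-1) (by norm_num))
  refine ⟨a - b, ?_⟩
  push_cast
  rw [← ha, ← hb, ← Matrix.trace_sub]
  congr 1
  module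

end Algebra

/-! ### Great circles in the unit normal sphere -/

section GreatCircle

variable {M : ℕ} {V : Submodule ℝ (E M)}

theorem exists_unit_orthogonal (hV : 2 ≤ Module.finrank ℝ V) {α : E M} (hα : α ∈ V)
    (hn : ‖α‖ = 1) : ∃ ξ ∈ V, ‖ξ‖ = 1 ∧ inner ℝ α ξ = 0 := by
  have hα0 : α ≠ 0 := by rintro rfl; simp at hn
  have h1 := Submodule.finrank_add_inf_finrank_orthogonal
    ((Submodule.span_singleton_le_iff_mem α V).2 hα)
  rw [finrank_span_singleton hα0] at h1
  have h2 : 0 < Module.finrank ℝ ((ℝ ∙ α)ᗮ ⊓ V : Submodule ℝ (E M)) := by omega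
  obtain ⟨⟨w, hw1, hw2⟩, hw0⟩ := Module.finrank_pos_iff_exists_ne_zero.1 h2
  have hw0' : w ≠ 0 := fun e => hw0 (Subtype.ext e)
  refine ⟨‖w‖⁻¹ • w, V.smul_mem _ hw2, ?_, ?_⟩
  · rw [norm_smul, norm_inv, norm_norm, inv_mul_cancel₀ (norm_ne_zero_iff.2 hw0')]
  · rw [inner_smul_right, Submodule.mem_orthogonal_singleton_iff_inner_right.1 hw1, mul_zero]

/-- This reduces analytic continuation over the normal sphere to one real variable. Dimension 2 is
needed for α = ±η, where any orthogonal ξ serves. -/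
theorem exists_great_circle (hV : 2 ≤ Module.finrank ℝ V) {η α : E M} (hη : η ∈ V)
    (hηn : ‖η‖ = 1) (hα : α ∈ V) (hn : ‖α‖ = 1) :
    ∃ ξ ∈ V, ‖ξ‖ = 1 ∧ inner ℝ η ξ = 0 ∧ ∃ s : ℝ, α = Real.cos s • η + Real.sin s • ξ := by
  set a := inner ℝ η α with ha
  set β := α - a • η with hβ
  have hηβ : inner ℝ η β = 0 := by
    rw [hβ, inner_sub_right, inner_smul_right, real_inner_self_eq_norm_sq, hηn]; simp [ha]
  have hnorm : a ^ 2 + ‖β‖ ^ 2 = 1 := by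
    have h1 : α = a • η + β := by rw [hβ]; abel
    have h2 : ‖α‖ ^ 2 = 1 := by rw [hn, one_pow]
    rw [h1, ← real_inner_self_eq_norm_sq] at h2
    simp only [inner_add_left, inner_add_right, inner_smul_left, inner_smul_right, hηβ,
      real_inner_comm η β, real_inner_self_eq_norm_sq, hηn] at h2
    simp at h2
    nlinarith
  have hβV : β ∈ V := V.sub_mem hα (V.smul_mem _ hη)
  have ha1 : -1 ≤ a := by nlinarith [sq_nonneg ‖β‖]
  have ha2 : a ≤ 1 := by nlinarith [sq_nonneg ‖β‖]
  obtain ⟨ξ, hξV, hξn, hξη, hξ⟩ : ∃ ξ ∈ V, ‖ξ‖ = 1 ∧ inner ℝ η ξ = 0 ∧ β = ‖β‖ • ξ := by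
    by_cases h0 : β = 0
    · obtain ⟨ξ, h1, h2, h3⟩ := exists_unit_orthogonal hV hη hηn
      exact ⟨ξ, h1, h2, h3, by rw [h0]; simp⟩
    · have h0' := norm_ne_zero_iff.2 h0
      refine ⟨‖β‖⁻¹ • β, V.smul_mem _ hβV, ?_, ?_, ?_⟩
      · rw [norm_smul, norm_inv, norm_norm, inv_mul_cancel₀ h0']
      · rw [inner_smul_right, hηβ, mul_zero]
      · rw [smul_smul, mul_inv_cancel₀ h0', one_smul]
  refine ⟨ξ, hξV, hξn, hξη, Real.arccos a, ?_⟩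
  rw [Real.cos_arccos ha1 ha2, Real.sin_arccos,
    show 1 - a ^ 2 = ‖β‖ ^ 2 by linarith, Real.sqrt_sq (norm_nonneg _), ← hξ, hβ]
  abel

end GreatCircle

/-! ### Analyticity along great circles of normals -/

section Analytic

variable {d M : ℕ} {ψ : E d → E M} {y : E d}

theorem normalForm_add_smul (u v : E M) (a b : ℝ) (i j : Fin d) :
    normalForm ψ y (a • u + b • v) i j = a * normalForm ψ y u i j + b * normalForm ψ y v i j := by
  simp [normalForm, inner_add_right, inner_smul_right]

theorem analyticAt_normalForm (u v : E M) (i j : Fin d) (s : ℝ) :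
    AnalyticAt ℝ (fun s => normalForm ψ y (Real.cos s • u + Real.sin s • v) i j) s := by
  simp only [normalForm_add_smul]
  exact (Real.analyticAt_cos.mul analyticAt_const).add (Real.analyticAt_sin.mul analyticAt_const)

theorem analyticAt_det_normalForm (c : ℝ) (u v : E M) (s : ℝ) :
    AnalyticAt ℝ (fun s => (normalForm ψ y (Real.cos s • u + Real.sin s • v) -
      c • inducedMetric ψ y).det) s := by
  simp only [Matrix.det_apply']
  refine Finset.analyticAt_fun_sum _ fun σ _ => ?_
  refine analyticAt_const.mul (Finset.analyticAt_fun_prod _ fun l _ => ?_)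
  exact (analyticAt_normalForm u v _ _ s).sub analyticAt_const

theorem analyticAt_matrix_mul {A B : ℝ → Matrix (Fin d) (Fin d) ℝ} {s : ℝ}
    (hA : ∀ i j, AnalyticAt ℝ (fun s => A s i j) s) (hB : ∀ i j, AnalyticAt ℝ (fun s => B s i j) s)
    (i j : Fin d) : AnalyticAt ℝ (fun s => (A s * B s) i j) s := by
  simp only [Matrix.mul_apply]
  exact Finset.analyticAt_fun_sum _ fun l _ => (hA i l).mul (hB l j)

theorem analyticAt_pow_three_sub (u v : E M) (s : ℝ) (i j : Fin d) :
    AnalyticAt ℝ (fun s => (((inducedMetric ψ y)⁻¹ *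
      normalForm ψ y (Real.cos s • u + Real.sin s • v)) ^ 3 -
      (inducedMetric ψ y)⁻¹ * normalForm ψ y (Real.cos s • u + Real.sin s • v)) i j) s := by
  have h1 := analyticAt_matrix_mul (s := s) (A := fun _ => (inducedMetric ψ y)⁻¹)
    (B := fun s => normalForm ψ y (Real.cos s • u + Real.sin s • v))
    (fun i j => analyticAt_const) (fun i j => analyticAt_normalForm u v i j s)
  have h2 := analyticAt_matrix_mul (analyticAt_matrix_mul h1 h1) h1
  simp only [pow_succ, pow_zero, one_mul, Matrix.sub_apply]
  exact (h2 i j).sub (h1 i j)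

end Analytic

/-! ### From one leaf to all unit normals -/

namespace IsFocalFactorization

variable {n d : ℕ} {ι : Type*} {U : Set (E n)} {φ N : E n → E (n + 2)} {κ : ι → ℝ} {m : ι → ℕ}
  {j : ι} {t : ℝ} {x₀ : E n} {π : E n → E d} {ψ : E d → E (n + 2)}

theorem parallelNormal_mem (h : IsFocalFactorization U φ N κ m j t x₀ π ψ) {x : E n}
    (hx : IsRegularPoint U φ N t π ψ x) : parallelNormal t φ N x ∈ normalSpace ψ (π x) := by
  refine mem_normalSpace.2 ⟨hx.orthogonal, ?_⟩
  rw [← hx.eq]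
  exact h.chart.inner_parallelMap_parallelNormal hx.mem

theorem finrank_normalSpace (h : IsFocalFactorization U φ N κ m j t x₀ π ψ) :
    Module.finrank ℝ (normalSpace ψ (π x₀)) = m j + 1 := by
  have hx := h.isRegularPoint
  have h1 := FocalRicci.finrank_normalSpace hx.injective
    (by rw [← hx.eq]; exact h.chart.norm_parallelMap hx.mem) (by
      intro v
      obtain ⟨w, rfl⟩ := hx.surjective v
      -- The parallel normal at distance t - π/2 is the parallel map at distance t.
      have h2 := h.chart.inner_fderiv_parallelNormal (t := t) hx.mem (t - Real.pi / 2) w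
      rw [← hx.fderiv_eq, ← hx.eq]
      convert h2 using 2
      simp [parallelMap, parallelNormal, Real.sin_sub, Real.cos_sub])
  have := h.dim_add
  omega

/-- Points of one fibre of π share a focal point, and their normals η fill a neighbourhood in its
unit normal sphere: the fibre and this sphere both have dimension m_j, and η is an immersion on the
fibre. -/
theorem eventually_exists_leaf (h : IsFocalFactorization U φ N κ m j t x₀ π ψ) {p : E n → Prop}
    (hp : ∀ᶠ x in 𝓝 x₀, p x) {ξ : E (n + 2)} (hξ : ξ ∈ normalSpace ψ (π x₀)) (hξn : ‖ξ‖ = 1)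
    (hξη : inner ℝ (parallelNormal t φ N x₀) ξ = 0) :
    ∀ᶠ s in 𝓝 (0 : ℝ), ∃ x, p x ∧ π x = π x₀ ∧ parallelNormal t φ N x =
      Real.cos s • parallelNormal t φ N x₀ + Real.sin s • ξ := by
  have hx₀ := h.isRegularPoint
  set η := parallelNormal t φ N with hη
  have hηV : η x₀ ∈ normalSpace ψ (π x₀) := h.parallelNormal_mem hx₀
  have hηn : ‖η x₀‖ = 1 := h.chart.norm_parallelNormal h.mem
  have hη0 : η x₀ ≠ 0 := by intro e; rw [e] at hηn; simp at hηn
  set W : Submodule ℝ (E (n + 2)) := (ℝ ∙ η x₀)ᗮ ⊓ normalSpace ψ (π x₀) with hW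
  have hWr : Module.finrank ℝ W = m j := by
    have h1 := Submodule.finrank_add_inf_finrank_orthogonal
      ((Submodule.span_singleton_le_iff_mem _ _).2 hηV)
    rw [finrank_span_singleton hη0, h.finrank_normalSpace] at h1
    change 1 + Module.finrank ℝ W = m j + 1 at h1
    omega
  set Q := W.orthogonalProjectionOnto with hQ
  have hηc : ContDiffAt ℝ 2 η x₀ := h.chart.contDiffAt_parallelNormal h.mem
  -- `W` is the tangent space of the normal sphere at η(x₀). The differential of Θ is injective,
  -- since dF and dη together determine dφ, and the dimensions agree, so Θ is locally open.
  let Θ : E n → E d × W := fun x => (π x, Q (η x))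
  have hΘ : ContDiffAt ℝ 2 Θ x₀ := h.contDiffAt_proj.prodMk (Q.contDiff.contDiffAt.comp x₀ hηc)
  have hΘd : HasFDerivAt Θ ((fderiv ℝ π x₀).prod (Q ∘L fderiv ℝ η x₀)) x₀ :=
    (h.contDiffAt_proj.differentiableAt (by simp)).hasFDerivAt.prodMk
      (Q.hasFDerivAt.comp x₀ (hηc.differentiableAt (by simp)).hasFDerivAt)
  have hinj : Function.Injective ((fderiv ℝ π x₀).prod (Q ∘L fderiv ℝ η x₀)).toLinearMap := by
    rw [← LinearMap.ker_eq_bot, LinearMap.ker_eq_bot']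
    intro v hv
    have h1 : fderiv ℝ π x₀ v = 0 := congrArg Prod.fst hv
    have h2 : Q (fderiv ℝ η x₀ v) = 0 := congrArg Prod.snd hv
    have h3 : fderiv ℝ η x₀ v ∈ W := by
      refine ⟨?_, mem_normalSpace.2 ⟨fun b => ?_, ?_⟩⟩
      · rw [SetLike.mem_coe, Submodule.mem_orthogonal_singleton_iff_inner_left]
        exact h.chart.inner_fderiv_parallelNormal_self h.mem v
      · have h4 := hx₀.second v b
        rw [h1, map_zero, _root_.zero_apply, inner_zero_left] at h4
        exact neg_eq_zero.1 h4.symm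
      · rw [← hx₀.eq, real_inner_comm]
        exact h.chart.inner_fderiv_parallelMap_self h.mem v
    have h4 := Submodule.orthogonalProjectionOnto_mem_subspace_eq_self (K := W) ⟨_, h3⟩
    rw [← hQ, h2] at h4
    have h5 : fderiv ℝ η x₀ v = 0 := (congrArg Subtype.val h4).symm
    have h6 : fderiv ℝ (parallelMap t φ N) x₀ v = 0 := by rw [hx₀.fderiv_eq, h1, map_zero]
    rw [hη, h.chart.fderiv_parallelNormal h.mem] at h5
    rw [h.chart.fderiv_parallelMap h.mem] at h6
    have h7 : fderiv ℝ φ x₀ v = 0 := by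
      have h8 : fderiv ℝ φ x₀ v = (Real.sin t ^ 2 + Real.cos t ^ 2) • fderiv ℝ φ x₀ v := by
        rw [Real.sin_sq_add_cos_sq, one_smul]
      have h9 : (Real.sin t ^ 2 + Real.cos t ^ 2) • fderiv ℝ φ x₀ v =
          Real.cos t • (Real.cos t • fderiv ℝ φ x₀ v + Real.sin t • fderiv ℝ N x₀ v) -
          Real.sin t • (-Real.sin t • fderiv ℝ φ x₀ v + Real.cos t • fderiv ℝ N x₀ v) := by module
      rw [h8, h9, h5, h6, smul_zero, smul_zero, sub_zero]
    exact h.chart.immersion x₀ h.mem (h7.trans (map_zero _).symm)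
  have hfr : Module.finrank ℝ (E n) = Module.finrank ℝ (E d × W) := by
    rw [Module.finrank_prod, hWr, finrank_euclideanSpace_fin, finrank_euclideanSpace_fin, h.dim_add]
  have hsurj := (LinearMap.injective_iff_surjective_of_finrank_eq_finrank hfr).1 hinj
  have hmap : map Θ (𝓝 x₀) = 𝓝 (Θ x₀) :=
    (hΘ.hasStrictFDerivAt' hΘd (by simp)).map_nhds_eq_of_surj (LinearMap.range_eq_top.2 hsurj)
  have hηη : Q (η x₀) = 0 := by
    rw [hQ, Submodule.orthogonalProjectionOnto_eq_zero_iff, Submodule.mem_orthogonal']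
    intro u hu
    exact Submodule.mem_orthogonal_singleton_iff_inner_right.1 hu.1
  have hξW : ξ ∈ W := ⟨Submodule.mem_orthogonal_singleton_iff_inner_right.2 hξη, hξ⟩
  -- The `W`-component determines a unit normal only up to the sign of its component along η(x₀);
  -- nearness fixes the sign as that of cos s.
  have hpos : ∀ᶠ x in 𝓝 x₀, 0 < inner ℝ (η x₀) (η x) := by
    have hc : ContinuousAt (fun x => inner ℝ (η x₀) (η x)) x₀ :=
      continuousAt_const.inner hηc.continuousAt
    refine hc.eventually (lt_mem_nhds ?_)
    change 0 < inner ℝ (η x₀) (η x₀)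
    rw [real_inner_self_eq_norm_sq, hηn]; norm_num
  have hev : ∀ᶠ z in 𝓝 (Θ x₀), ∃ x, (p x ∧ IsRegularPoint U φ N t π ψ x ∧
      0 < inner ℝ (η x₀) (η x)) ∧ Θ x = z := by
    rw [← hmap, eventually_map]
    filter_upwards [hp, h.eventually_isRegularPoint, hpos] with x h1 h2 h3
    exact ⟨x, ⟨h1, h2, h3⟩, rfl⟩
  have hcurve : Tendsto (fun s : ℝ => ((π x₀, Real.sin s • ⟨ξ, hξW⟩) : E d × W)) (𝓝 0)
      (𝓝 (Θ x₀)) := by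
    have hc : Continuous (fun s : ℝ => ((π x₀, Real.sin s • ⟨ξ, hξW⟩) : E d × W)) := by fun_prop
    have := hc.tendsto 0
    simp only [Real.sin_zero, zero_smul] at this
    rwa [show Θ x₀ = (π x₀, 0) from Prod.ext rfl hηη]
  have hcos : ∀ᶠ s in 𝓝 (0 : ℝ), 0 < Real.cos s :=
    Real.continuous_cos.continuousAt.eventually (lt_mem_nhds (by rw [Real.cos_zero]; norm_num))
  filter_upwards [hcurve.eventually hev, hcos] with s ⟨x, ⟨hpx, hx, hxpos⟩, hxs⟩ hs
  have hπx : π x = π x₀ := congrArg Prod.fst hxs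
  have hQx : Q (η x) = Real.sin s • ⟨ξ, hξW⟩ := congrArg Prod.snd hxs
  refine ⟨x, hpx, hπx, ?_⟩
  have hxV : η x ∈ normalSpace ψ (π x₀) := hπx ▸ h.parallelNormal_mem hx
  set a := inner ℝ (η x₀) (η x) with ha
  have hmem : η x - a • η x₀ ∈ W := by
    refine ⟨Submodule.mem_orthogonal_singleton_iff_inner_right.2 ?_,
      Submodule.sub_mem _ hxV (Submodule.smul_mem _ _ hηV)⟩
    rw [inner_sub_right, inner_smul_right, real_inner_self_eq_norm_sq, hηn, ← ha]
    ring
  have hdec : η x - a • η x₀ = Real.sin s • ξ := by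
    have h1 := Submodule.orthogonalProjectionOnto_mem_subspace_eq_self (K := W) ⟨_, hmem⟩
    rw [← hQ, map_sub, map_smul, hηη, smul_zero, sub_zero, hQx] at h1
    exact (congrArg Subtype.val h1).symm
  have hdec' : η x = a • η x₀ + Real.sin s • ξ := by rw [← hdec]; abel
  have hsq : a ^ 2 + Real.sin s ^ 2 = 1 := by
    have h1 : ‖η x‖ ^ 2 = 1 := by rw [h.chart.norm_parallelNormal hx.mem, one_pow]
    rw [hdec', ← real_inner_self_eq_norm_sq] at h1
    simp only [inner_add_left, inner_add_right, inner_smul_left, inner_smul_right, hξη,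
      real_inner_comm (η x₀) ξ, real_inner_self_eq_norm_sq, hηn, hξn] at h1
    simp at h1
    nlinarith
  have : a = Real.cos s := by
    have := Real.sin_sq_add_cos_sq s
    exact (pow_left_inj₀ hxpos.le hs.le two_ne_zero).1 (by linarith)
  rw [hdec', this]

/-- Join η(x₀) to α by a great circle: the function vanishes for small angles by
`eventually_exists_leaf`, hence everywhere by the identity theorem. -/
theorem eq_zero_of_forall_leaf (h : IsFocalFactorization U φ N κ m j t x₀ π ψ)
    {f : E (n + 2) → ℝ} (hf : ∀ u v s, AnalyticAt ℝ (fun s => f (Real.cos s • u + Real.sin s • v)) s)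
    (h0 : ∀ x, IsRegularPoint U φ N t π ψ x → π x = π x₀ → f (parallelNormal t φ N x) = 0)
    {α : E (n + 2)} (hα : α ∈ normalSpace ψ (π x₀)) (hn : ‖α‖ = 1) : f α = 0 := by
  have hV : 2 ≤ Module.finrank ℝ (normalSpace ψ (π x₀)) := by
    have := h.chart.mult_pos j
    rw [h.finrank_normalSpace]; omega
  obtain ⟨ξ, hξ, hξn, hξη, s, rfl⟩ := exists_great_circle hV (h.parallelNormal_mem h.isRegularPoint)
    (h.chart.norm_parallelNormal h.mem) hα hn
  have han : AnalyticOnNhd ℝ (fun s => f (Real.cos s • parallelNormal t φ N x₀ +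
    Real.sin s • ξ)) Set.univ := fun s _ => hf _ _ s
  refine han.eqOn_zero_of_preconnected_of_eventuallyEq_zero isPreconnected_univ
    (Set.mem_univ 0) ?_ (Set.mem_univ s)
  filter_upwards [h.eventually_exists_leaf h.eventually_isRegularPoint hξ hξn hξη]
    with s ⟨x, hx, hπ, hs⟩
  rw [← hs, h0 x hx hπ]
  rfl

/-- The principal curvatures of a focal manifold are symmetric about `0`. -/
theorem exists_focalCurvature_eq_neg (h : IsFocalFactorization U φ N κ m j t x₀ π ψ) {k : ι}
    (hk : k ≠ j) : ∃ l, l ≠ j ∧ focalCurvature κ j l = -focalCurvature κ j k := by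
  have hx₀ := h.isRegularPoint
  refine h.exists_focalCurvature_eq hx₀ ?_
  -- The characteristic equation is continued to the antipodal normal -η, whose shape operator is
  -- the negative.
  have h1 := h.eq_zero_of_forall_leaf (f := fun α => (normalForm ψ (π x₀) α -
    focalCurvature κ j k • inducedMetric ψ (π x₀)).det)
    (fun u v s => analyticAt_det_normalForm _ u v s)
    (fun x hx hπ => by rw [← hπ]; exact h.det_normalForm_sub hx hk)
    (Submodule.neg_mem _ (h.parallelNormal_mem hx₀))
    (by rw [norm_neg]; exact h.chart.norm_parallelNormal h.mem)
  have h2 : normalForm ψ (π x₀) (-parallelNormal t φ N x₀) =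
      -normalForm ψ (π x₀) (parallelNormal t φ N x₀) := by
    ext i l; simp [normalForm]
  simp only [h2] at h1
  rw [show normalForm ψ (π x₀) (parallelNormal t φ N x₀) -
    (-focalCurvature κ j k) • inducedMetric ψ (π x₀) =
    -(-normalForm ψ (π x₀) (parallelNormal t φ N x₀) -
      focalCurvature κ j k • inducedMetric ψ (π x₀)) by module, Matrix.det_neg, h1, mul_zero]

theorem shape_pow_three (h : IsFocalFactorization U φ N κ m j t x₀ π ψ)
    (hc : ∀ k ≠ j, focalCurvature κ j k ^ 3 = focalCurvature κ j k) {α : E (n + 2)}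
    (hα : α ∈ normalSpace ψ (π x₀)) (hn : ‖α‖ = 1) :
    ((inducedMetric ψ (π x₀))⁻¹ * normalForm ψ (π x₀) α) ^ 3 =
      (inducedMetric ψ (π x₀))⁻¹ * normalForm ψ (π x₀) α := by
  ext a b
  refine sub_eq_zero.1 (h.eq_zero_of_forall_leaf (f := fun α =>
    (((inducedMetric ψ (π x₀))⁻¹ * normalForm ψ (π x₀) α) ^ 3 -
      (inducedMetric ψ (π x₀))⁻¹ * normalForm ψ (π x₀) α) a b)
    (fun u v s => analyticAt_pow_three_sub u v s a b) (fun x hx hπ => ?_) hα hn)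
  rw [← hπ, h.pow_three_eq hx hc, sub_self, Matrix.zero_apply]

theorem shape_trace (h : IsFocalFactorization U φ N κ m j t x₀ π ψ)
    (hc : ∀ k ≠ j, focalCurvature κ j k ^ 3 = focalCurvature κ j k) {α : E (n + 2)}
    (hα : α ∈ normalSpace ψ (π x₀)) (hn : ‖α‖ = 1) :
    ((inducedMetric ψ (π x₀))⁻¹ * normalForm ψ (π x₀) α).trace = 0 := by
  have hV : 2 ≤ Module.finrank ℝ (normalSpace ψ (π x₀)) := by
    have := h.chart.mult_pos j
    rw [h.finrank_normalSpace]; omega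
  obtain ⟨ξ, hξ, hξn, hξα⟩ := exists_unit_orthogonal hV hα hn
  set T : E (n + 2) → ℝ := fun α => ((inducedMetric ψ (π x₀))⁻¹ * normalForm ψ (π x₀) α).trace
  have hT : ∀ a b : ℝ, T (a • α + b • ξ) = a * T α + b * T ξ := by
    intro a b
    have : normalForm ψ (π x₀) (a • α + b • ξ) =
        a • normalForm ψ (π x₀) α + b • normalForm ψ (π x₀) ξ := by
      ext i l; rw [normalForm_add_smul]; rfl
    simp only [T, this, mul_add, Matrix.mul_smul, Matrix.trace_add, Matrix.trace_smul, smul_eq_mul]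
  have hint : ∀ s : ℝ, ∃ z : ℤ, Real.cos s * T α + Real.sin s * T ξ = z := by
    intro s
    rw [← hT]
    refine exists_trace_eq_intCast (h.shape_pow_three hc (Submodule.add_mem _
      (Submodule.smul_mem _ _ hα) (Submodule.smul_mem _ _ hξ)) ?_)
    have h1 : ‖Real.cos s • α + Real.sin s • ξ‖ ^ 2 = 1 := by
      rw [← real_inner_self_eq_norm_sq]
      simp only [inner_add_left, inner_add_right, inner_smul_left, inner_smul_right, hξα,
        real_inner_comm α ξ, real_inner_self_eq_norm_sq, hn, hξn]
      simp
      nlinarith [Real.sin_sq_add_cos_sq s]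
    nlinarith [norm_nonneg (Real.cos s • α + Real.sin s • ξ)]
  choose z hz using hint
  have hcont : Continuous fun s => ((z s : ℤ) : ℝ) := by
    simp only [← hz]
    fun_prop
  have hzc : Continuous z := Int.isClosedEmbedding_coe_real.isEmbedding.continuous_iff.2 hcont
  -- A continuous integer-valued function is constant; its values at 0 and π are the traces for α
  -- and -α.
  have hzz : z 0 = z Real.pi := (isPreconnected_univ (α := ℝ)).constant hzc.continuousOn
    (Set.mem_univ _) (Set.mem_univ _)
  have e0 := hz 0
  have e1 := hz Real.pi
  rw [← hzz, ← e0] at e1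
  simp at e1
  change T α = 0
  linarith

end IsFocalFactorization

/-! ### Isoparametric hypersurfaces yield principal charts -/

section Chart

variable {n : ℕ} {M : Set (E (n + 2))} {ν : E (n + 2) → E (n + 2)} {g : ℕ} {κ : Fin g → ℝ}
  {m : Fin g → ℕ} {U : Set (E n)} {φ : E n → E (n + 2)} {x : E n}

theorem IsLocalParam.mem {k N : ℕ} {S : Set (E N)} {U : Set (E k)} {φ : E k → E N}
    (h : IsLocalParam S U φ) {x : E k} (hx : x ∈ U) : φ x ∈ S := by
  obtain ⟨W, -, hW⟩ := h.image_open U subset_rfl h.isOpen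
  have : φ x ∈ φ '' U := ⟨x, hx, rfl⟩
  rw [hW] at this
  exact this.1

theorem secondForm_comm (hν : IsUnitNormalField n M ν) (hφ : IsLocalParam M U φ) (hx : x ∈ U)
    (i j : Fin n) : secondForm ν φ x i j = secondForm ν φ x j i := by
  have hs := hφ.smooth
  have hsec : ∀ i j, secondForm ν φ x i j =
      inner ℝ (ν (φ x)) (partialDeriv (partialDeriv φ j) i x) := by
    intro i j
    have h1 := inner_fderiv_add_eq_zero (f := ν ∘ φ) (h := partialDeriv φ j) (c := 0)
      (((hν.smooth U φ hφ).contDiffAt (hφ.isOpen.mem_nhds hx)).differentiableAt (by simp))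
      (((contDiffOn_partialDeriv hφ.isOpen hs j).contDiffAt
        (hφ.isOpen.mem_nhds hx)).differentiableAt (by simp))
      (by filter_upwards [hφ.isOpen.mem_nhds hx] with z hz using hν.normal U φ hφ z hz _)
      (EuclideanSpace.single i 1)
    rw [add_eq_zero_iff_neg_eq'] at h1
    exact h1
  rw [hsec, hsec, partialDeriv_comm ((hs.contDiffAt (hφ.isOpen.mem_nhds hx)).of_le two_le_infty)]

theorem inner_fderiv_normal_eq (ν : E (n + 2) → E (n + 2)) (φ : E n → E (n + 2)) (x v w : E n) :
    inner ℝ (fderiv ℝ (ν ∘ φ) x v) (fderiv ℝ φ x w) =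
      - ∑ i, ∑ j, secondForm ν φ x i j * v i * w j := by
  simp only [fderiv_eq_sum_partialDeriv, sum_inner, inner_sum, inner_smul_left, inner_smul_right,
    secondForm, Matrix.of_apply, Finset.mul_sum, ← Finset.sum_neg_distrib]
  rw [Finset.sum_comm]
  refine Finset.sum_congr rfl fun i _ => Finset.sum_congr rfl fun j _ => ?_
  simp; ring

/-- The Weingarten equation. -/
theorem fderiv_normal_eq_neg (hM : IsSphereHypersurface n M) (hν : IsUnitNormalField n M ν)
    (hφ : IsLocalParam M U φ) (hx : x ∈ U) (v : E n) :
    fderiv ℝ (ν ∘ φ) x v =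
      -fderiv ℝ φ x (WithLp.toLp 2 ((shapeOperator ν φ x).mulVec v.ofLp)) := by
  have hdφ : DifferentiableAt ℝ φ x :=
    (hφ.smooth.contDiffAt (hφ.isOpen.mem_nhds hx)).differentiableAt (by simp)
  have hdν : DifferentiableAt ℝ (ν ∘ φ) x :=
    ((hν.smooth U φ hφ).contDiffAt (hφ.isOpen.mem_nhds hx)).differentiableAt (by simp)
  have hev := hφ.isOpen.mem_nhds hx
  have hn1 : ∀ y ∈ U, ‖φ y‖ = 1 := fun y hy => by
    simpa using hM.subset_sphere (hφ.mem hy)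
  have hφφ := inner_fderiv_self_eq_zero hdφ (by filter_upwards [hev] with y hy using hn1 y hy)
  have hνν := inner_fderiv_self_eq_zero hdν
    (by filter_upwards [hev] with y hy using hν.norm_eq_one _ (hφ.mem hy)) v
  have hνφ := inner_fderiv_add_eq_zero hdν hdφ
    (by filter_upwards [hev] with y hy using hν.tangent_sphere _ (hφ.mem hy)) v
  have hnor := hν.normal U φ hφ x hx
  rw [Function.comp_apply, hnor, zero_add] at hνφ
  have hdet : IsUnit (inducedMetric φ x).det :=
    (posDef_inducedMetric (hφ.immersion x hx)).det_pos.ne'.isUnit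
  set w := WithLp.toLp 2 ((shapeOperator ν φ x).mulVec v.ofLp) with hw
  set u := fderiv ℝ (ν ∘ φ) x v + fderiv ℝ φ x w with hu
  have hgS : (inducedMetric φ x).mulVec w.ofLp = (secondForm ν φ x).mulVec v.ofLp := by
    rw [hw, shapeOperator, Matrix.mulVec_mulVec, Matrix.mul_nonsing_inv_cancel_left _ _ hdet]
  have hut : ∀ b, inner ℝ (fderiv ℝ φ x b) u = 0 := by
    intro b
    rw [hu, inner_add_right, real_inner_comm (fderiv ℝ (ν ∘ φ) x v), inner_fderiv_normal_eq,
      ← dotProduct_inducedMetric]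
    have e1 : ∑ i, ∑ j, inducedMetric φ x i j * b i * w j =
        ∑ i, b i * (inducedMetric φ x).mulVec w.ofLp i := by
      simp only [Matrix.mulVec, dotProduct, Finset.mul_sum]
      exact Finset.sum_congr rfl fun i _ => Finset.sum_congr rfl fun j _ => by ring
    have e2 : ∑ i, ∑ j, secondForm ν φ x i j * v i * b j =
        ∑ i, b i * (secondForm ν φ x).mulVec v.ofLp i := by
      rw [Finset.sum_comm]
      simp only [Matrix.mulVec, dotProduct, Finset.mul_sum]
      exact Finset.sum_congr rfl fun i _ => Finset.sum_congr rfl fun j _ => by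
        rw [secondForm_comm hν hφ hx]; ring
    rw [e1, e2, hgS, neg_add_cancel]
  have huφ : inner ℝ (φ x) u = 0 := by
    rw [hu, inner_add_right, real_inner_comm, real_inner_comm (fderiv ℝ φ x w), hνφ, hφφ, add_zero]
  have huν : inner ℝ (ν (φ x)) u = 0 := by
    rw [hu, inner_add_right, hnor, add_zero, real_inner_comm]
    exact hνν
  -- The defect `u` lies in the normal line spanned by ν and is orthogonal to ν, so it vanishes.
  have hmem : u ∈ normalSpace φ x := mem_normalSpace.2 ⟨hut, huφ⟩
  have hνmem : ν (φ x) ∈ normalSpace φ x := mem_normalSpace.2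
    ⟨fun b => by rw [real_inner_comm]; exact hnor b,
      by rw [real_inner_comm]; exact hν.tangent_sphere _ (hφ.mem hx)⟩
  have hfr : Module.finrank ℝ (normalSpace φ x) = 1 := by
    have := finrank_normalSpace (hφ.immersion x hx) (hn1 x hx) hφφ
    omega
  have hν1 := hν.norm_eq_one _ (hφ.mem hx)
  have hν0 : (⟨ν (φ x), hνmem⟩ : normalSpace φ x) ≠ 0 := by
    intro e
    have e' : ν (φ x) = 0 := congrArg Subtype.val e
    rw [e', norm_zero] at hν1
    exact zero_ne_one hν1
  obtain ⟨c, hc⟩ := (finrank_eq_one_iff_of_nonzero' _ hν0).1 hfr ⟨u, hmem⟩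
  have hc' : c • ν (φ x) = u := congrArg Subtype.val hc
  rw [← hc', inner_smul_right, real_inner_self_eq_norm_sq, hν1] at huν
  have hc0 : c = 0 := by simpa using huν
  rw [hc0, zero_smul] at hc'
  exact eq_neg_of_add_eq_zero_left hc'.symm

theorem mem_ker_iff (hM : IsSphereHypersurface n M) (hν : IsUnitNormalField n M ν)
    (hφ : IsLocalParam M U φ) (hx : x ∈ U) (r : ℝ) (v : E n) :
    fderiv ℝ (ν ∘ φ) x v + r • fderiv ℝ φ x v = 0 ↔
      v.ofLp ∈ Module.End.eigenspace (Matrix.toLin' (shapeOperator ν φ x)) r := by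
  rw [fderiv_normal_eq_neg hM hν hφ hx, neg_add_eq_zero, ← map_smul,
    (hφ.immersion x hx).eq_iff, Module.End.mem_eigenspace_iff, Matrix.toLin'_apply]
  constructor
  · intro h; exact congrArg WithLp.ofLp h
  · intro h; exact congrArg (WithLp.toLp 2) h

theorem iSup_ker_eq_top (hM : IsSphereHypersurface n M) (hν : IsUnitNormalField n M ν)
    (hiso : IsIsoparametric n M ν κ m) (hφ : IsLocalParam M U φ) (hx : x ∈ U) :
    ⨆ k, LinearMap.ker (fderiv ℝ (ν ∘ φ) x + κ k • fderiv ℝ φ x).toLinearMap = ⊤ := by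
  set e := LinearEquiv.ofInjective (fderiv ℝ φ x).toLinearMap (hφ.immersion x hx) with he
  set S : E n →ₗ[ℝ] E n := (WithLp.linearEquiv 2 ℝ (Fin n → ℝ)).symm.toLinearMap ∘ₗ
    Matrix.toLin' (shapeOperator ν φ x) ∘ₗ (WithLp.linearEquiv 2 ℝ (Fin n → ℝ)).toLinearMap with hS
  have hSv : ∀ v, fderiv ℝ φ x (S v) = -fderiv ℝ (ν ∘ φ) x v := fun v => by
    rw [fderiv_normal_eq_neg hM hν hφ hx, neg_neg]
    rfl
  -- The shape operator is self-adjoint for the induced metric, not for the standard one of `E n`.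
  -- Moved to the tangent space inside the ambient space, it falls under the spectral theorem.
  set T := e.toLinearMap ∘ₗ S ∘ₗ e.symm.toLinearMap with hT
  have hinner : ∀ a b, inner ℝ (fderiv ℝ φ x (S a)) (fderiv ℝ φ x b) =
      ∑ i, ∑ j, secondForm ν φ x i j * a i * b j := fun a b => by
    rw [hSv, inner_neg_left, inner_fderiv_normal_eq, neg_neg]
  have hsymm : T.IsSymmetric := by
    intro y z
    obtain ⟨a, rfl⟩ := e.surjective y
    obtain ⟨b, rfl⟩ := e.surjective z
    have h1 : ∀ a, T (e a) = e (S a) := fun a => by simp [hT]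
    rw [h1, h1]
    change inner ℝ (fderiv ℝ φ x (S a)) (fderiv ℝ φ x b) =
      inner ℝ (fderiv ℝ φ x a) (fderiv ℝ φ x (S b))
    rw [real_inner_comm (fderiv ℝ φ x (S b)), hinner, hinner, Finset.sum_comm]
    exact Finset.sum_congr rfl fun i _ => Finset.sum_congr rfl fun j _ => by
      rw [secondForm_comm hν hφ hx]; ring
  have htop : ⨆ μ, Module.End.eigenspace T μ = ⊤ :=
    Submodule.orthogonal_eq_bot_iff.1 hsymm.orthogonalComplement_iSup_eigenspaces_eq_bot
  rw [eq_top_iff]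
  intro v _
  have hv : e v ∈ ⨆ μ, Module.End.eigenspace T μ := by rw [htop]; trivial
  have key : e.symm (e v) ∈
      ⨆ k, LinearMap.ker (fderiv ℝ (ν ∘ φ) x + κ k • fderiv ℝ φ x).toLinearMap := by
    refine Submodule.iSup_induction _ (motive := fun y => e.symm y ∈
      ⨆ k, LinearMap.ker (fderiv ℝ (ν ∘ φ) x + κ k • fderiv ℝ φ x).toLinearMap) hv ?_ ?_ ?_
    · intro μ y hy
      obtain ⟨w, rfl⟩ := e.surjective y
      rw [e.symm_apply_apply]
      by_cases hw : w = 0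
      · rw [hw]; exact Submodule.zero_mem _
      rw [Module.End.mem_eigenspace_iff] at hy
      have h1 : S w = μ • w := by
        apply e.injective
        rw [map_smul, ← hy]
        simp [hT]
      have h2 : fderiv ℝ (ν ∘ φ) x w + μ • fderiv ℝ φ x w = 0 := by
        rw [← map_smul, ← h1, hSv, add_neg_cancel]
      obtain ⟨k, rfl⟩ := (hiso.eigenvalues U φ hφ x hx μ).1
        (Module.End.hasEigenvalue_of_hasEigenvector
          ⟨(mem_ker_iff hM hν hφ hx μ w).1 h2, by simpa using hw⟩)
      exact Submodule.mem_iSup_of_mem k h2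
    · rw [map_zero]; exact Submodule.zero_mem _
    · intro y z hy hz
      rw [map_add]; exact Submodule.add_mem _ hy hz
  rwa [e.symm_apply_apply] at key

theorem isPrincipalChart (hM : IsSphereHypersurface n M) (hν : IsUnitNormalField n M ν)
    (hiso : IsIsoparametric n M ν κ m) (hφ : IsLocalParam M U φ) (hne : U.Nonempty) :
    IsPrincipalChart U φ (ν ∘ φ) κ m where
  isOpen := hφ.isOpen
  smooth := hφ.smooth
  smooth_normal := hν.smooth U φ hφ
  immersion := hφ.immersion
  norm_eq_one x hx := by simpa using hM.subset_sphere (hφ.mem hx)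
  norm_normal x hx := hν.norm_eq_one _ (hφ.mem hx)
  orthogonal x hx := by rw [real_inner_comm]; exact hν.tangent_sphere _ (hφ.mem hx)
  normal x hx v := hν.normal U φ hφ x hx v
  iSup_ker x hx := iSup_ker_eq_top hM hν hiso hφ hx
  finrank_ker x hx k := by
    have : Submodule.map (WithLp.linearEquiv 2 ℝ (Fin n → ℝ)).toLinearMap
        (LinearMap.ker (fderiv ℝ (ν ∘ φ) x + κ k • fderiv ℝ φ x).toLinearMap) =
        Module.End.eigenspace (Matrix.toLin' (shapeOperator ν φ x)) (κ k) := by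
      ext y
      rw [Submodule.mem_map]
      constructor
      · rintro ⟨v, hv, rfl⟩
        exact (mem_ker_iff hM hν hφ hx (κ k) v).1 hv
      · intro hy
        exact ⟨WithLp.toLp 2 y, (mem_ker_iff hM hν hφ hx (κ k) (WithLp.toLp 2 y)).2 hy, rfl⟩
    rw [← hiso.multiplicity U φ hφ x hx k, ← this]
    exact (LinearEquiv.finrank_map_eq (WithLp.linearEquiv 2 ℝ (Fin n → ℝ)) _).symm
  mult_pos k := by
    obtain ⟨x, hx⟩ := hne
    have h1 := (hiso.eigenvalues U φ hφ x hx (κ k)).2 ⟨k, rfl⟩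
    rw [← hiso.multiplicity U φ hφ x hx k]
    exact Nat.pos_of_ne_zero fun h0 => h1 (Submodule.finrank_eq_zero.1 h0)
  eq_curvature x hx r v hv h := (hiso.eigenvalues U φ hφ x hx r).1
    (Module.End.hasEigenvalue_of_hasEigenvector
      ⟨(mem_ker_iff hM hν hφ hx r v).1 h, by simpa using hv⟩)

theorem sum_mult_le (hiso : IsIsoparametric n M ν κ m) (hφ : IsLocalParam M U φ) (hx : x ∈ U) :
    ∑ k, m k ≤ n := by
  classical
  have hind := (Module.End.eigenspaces_iSupIndep
    (Matrix.toLin' (shapeOperator ν φ x))).comp hiso.distinct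
  have h1 := LinearMap.finrank_le_finrank_of_injective (f := DirectSum.coeLinearMap
    (fun k => Module.End.eigenspace (Matrix.toLin' (shapeOperator ν φ x)) (κ k)))
    hind.dfinsupp_lsum_injective
  rw [Module.finrank_directSum] at h1
  simpa [hiso.multiplicity U φ hφ x hx] using h1

end Chart

/-! ### Hausdorff dimension of focal sets -/

section Dimension

variable {n N d r : ℕ}

theorem exists_mem_nhds_dimH_image_le {F : E n → E N} {x₀ : E n} (hF : ContDiffAt ℝ 2 F x₀)
    (hr : ∀ᶠ x in 𝓝 x₀, Module.finrank ℝ (LinearMap.range (fderiv ℝ F x).toLinearMap) = r) :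
    ∃ A ∈ 𝓝 x₀, dimH (F '' A) ≤ r := by
  obtain ⟨π, ψ, hπ, hψ, hF⟩ := exists_factorization_of_finrank_range_eq hF hr
  obtain ⟨ε, hε, hball⟩ := Metric.eventually_nhds_iff_ball.1 (hψ.eventually (by simp))
  refine ⟨{x | F x = ψ (π x)} ∩ π ⁻¹' Metric.ball (π x₀) ε,
    inter_mem hF (hπ.continuousAt (Metric.ball_mem_nhds _ hε)), ?_⟩
  have hsub : F '' ({x | F x = ψ (π x)} ∩ π ⁻¹' Metric.ball (π x₀) ε) ⊆
      ψ '' Metric.ball (π x₀) ε := by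
    rintro _ ⟨x, ⟨hx, hxb⟩, rfl⟩
    exact ⟨π x, hxb, hx.symm⟩
  have hcd : ContDiffOn ℝ 1 ψ (Metric.ball (π x₀) ε) := fun y hy =>
    ((hball y hy).of_le (by norm_num)).contDiffWithinAt
  calc dimH _ ≤ dimH (ψ '' Metric.ball (π x₀) ε) := dimH_mono hsub
    _ ≤ dimH (Metric.ball (π x₀) ε) := hcd.dimH_image_le (convex_ball _ _) subset_rfl
    _ = r := by
      rw [Real.dimH_of_mem_nhds (Metric.ball_mem_nhds _ hε), finrank_euclideanSpace_fin]

/-- A linear left inverse of dψ is Lipschitz and maps the parametrized patch onto a neighbourhood in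
`E d`. -/
theorem IsLocalParam.le_dimH {S : Set (E N)} {U : Set (E d)} {ψ : E d → E N}
    (hψ : IsLocalParam S U ψ) {y₀ : E d} (hy₀ : y₀ ∈ U) : (d : ENNReal) ≤ dimH S := by
  have hψd : ContDiffAt ℝ 2 ψ y₀ :=
    (hψ.smooth.contDiffAt (hψ.isOpen.mem_nhds hy₀)).of_le two_le_infty
  obtain ⟨L, hL⟩ := (fderiv ℝ ψ y₀).toLinearMap.exists_leftInverse_of_injective
    (LinearMap.ker_eq_bot.2 (hψ.immersion y₀ hy₀))
  let P : E N →L[ℝ] E d := L.toContinuousLinearMap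
  have hder : HasFDerivAt (P ∘ ψ) (ContinuousLinearEquiv.refl ℝ (E d) : E d →L[ℝ] E d) y₀ := by
    refine (P.hasFDerivAt.comp y₀ (hψd.differentiableAt (by simp)).hasFDerivAt).congr_fderiv ?_
    ext1 v
    exact congrArg (fun M => M v) hL
  have hmap : map (P ∘ ψ) (𝓝 y₀) = 𝓝 (P (ψ y₀)) :=
    ((P.contDiff.contDiffAt.comp y₀ hψd).hasStrictFDerivAt' hder
      (by simp)).map_nhds_eq_of_equiv
  have hnhds : (P ∘ ψ) '' U ∈ 𝓝 (P (ψ y₀)) := by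
    rw [← hmap]
    exact image_mem_map (hψ.isOpen.mem_nhds hy₀)
  calc (d : ENNReal) = dimH ((P ∘ ψ) '' U) := by
        rw [Real.dimH_of_mem_nhds hnhds, finrank_euclideanSpace_fin]
    _ = dimH (P '' (ψ '' U)) := by rw [Set.image_comp]
    _ ≤ dimH (ψ '' U) := P.lipschitz.dimH_image_le _
    _ ≤ dimH S := dimH_mono (by rintro _ ⟨y, hy, rfl⟩; exact hψ.mem hy)

/-- The focal sets of an isoparametric hypersurface are small. -/
theorem dimH_parallelSet_le {M : Set (E (n + 2))} {ν : E (n + 2) → E (n + 2)} {g : ℕ}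
    {κ : Fin g → ℝ} {m : Fin g → ℕ} (hM : IsSphereHypersurface n M) (hν : IsUnitNormalField n M ν)
    (hiso : IsIsoparametric n M ν κ m) {j : Fin g} {t : ℝ} (hs : Real.sin t ≠ 0)
    (hc : Real.cos t = κ j * Real.sin t) : dimH (parallelSet M ν t) ≤ (n - m j : ℕ) := by
  set f : E (n + 2) → E (n + 2) := fun p => Real.cos t • p + Real.sin t • ν p with hf
  have hloc : ∀ p ∈ M, ∃ W : Set (E (n + 2)), W ∈ 𝓝[M] p ∧ dimH (f '' W) ≤ (n - m j : ℕ) := by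
    intro p hp
    obtain ⟨U, φ, hφ, x₀, hx₀, rfl⟩ := hM.submanifold p hp
    have hchart := isPrincipalChart hM hν hiso hφ ⟨x₀, hx₀⟩
    obtain ⟨A, hA, hdim⟩ := exists_mem_nhds_dimH_image_le (r := n - m j)
      (hchart.contDiffAt_parallelMap (t := t) hx₀) (by
        filter_upwards [hφ.isOpen.mem_nhds hx₀] with x hx
        have := hchart.finrank_range_fderiv_parallelMap hx hs hc
        omega)
    obtain ⟨B, hBA, hB, hxB⟩ := mem_nhds_iff.1 (inter_mem hA (hφ.isOpen.mem_nhds hx₀))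
    obtain ⟨W, hW, hWB⟩ := hφ.image_open B (fun y hy => (hBA hy).2) hB
    refine ⟨φ '' B, ?_, ?_⟩
    · have hmem : φ x₀ ∈ φ '' B := ⟨x₀, hxB, rfl⟩
      rw [hWB] at hmem ⊢
      exact inter_mem_nhdsWithin M (hW.mem_nhds hmem.2)
    · refine (dimH_mono ?_).trans hdim
      rintro _ ⟨_, ⟨y, hy, rfl⟩, rfl⟩
      exact ⟨y, (hBA hy).1, rfl⟩
  choose! W hW hWd using hloc
  obtain ⟨c, hcM, hcc, hcover⟩ := TopologicalSpace.countable_cover_nhdsWithin hW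
  have hsub : parallelSet M ν t ⊆ ⋃ p ∈ c, f '' W p := by
    rintro _ ⟨p, hp, rfl⟩
    obtain ⟨q, hq, hpq⟩ := Set.mem_iUnion₂.1 (hcover hp)
    exact Set.mem_iUnion₂.2 ⟨q, hq, p, hpq, rfl⟩
  refine (dimH_mono hsub).trans ?_
  rw [dimH_bUnion hcc]
  exact iSup₂_le fun p hp => hWd p (hcM hp)

end Dimension

/-! ### Identifying the given focal manifold -/

section Main

variable {n d : ℕ} {M : Set (E (n + 2))} {ν : E (n + 2) → E (n + 2)}

theorem exists_sin_cos_eq (r : ℝ) : ∃ t : ℝ, Real.sin t ≠ 0 ∧ Real.cos t = r * Real.sin t := by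
  refine ⟨Real.pi / 2 - Real.arctan r, ?_, ?_⟩
  · rw [Real.sin_pi_div_two_sub]
    exact (Real.cos_arctan_pos r).ne'
  · rw [Real.cos_pi_div_two_sub, Real.sin_pi_div_two_sub,
      ← Real.tan_mul_cos (Real.cos_arctan_pos r).ne', Real.tan_arctan]

/-- The algebra needs the symmetry at all four κ_j, not only the one giving the chosen focal
manifold. The constant rank theorem supplies a local factorization for each, without any global
regularity of the focal set. -/
theorem exists_focalCurvature_eq_neg {κ : Fin 4 → ℝ} {m : Fin 4 → ℕ} {U : Set (E n)}
    {φ N : E n → E (n + 2)} (hchart : IsPrincipalChart U φ N κ m) (hκ : Function.Injective κ)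
    {x₀ : E n} (hx₀ : x₀ ∈ U) {j k : Fin 4} (hk : k ≠ j) :
    ∃ l, l ≠ j ∧ focalCurvature κ j l = -focalCurvature κ j k := by
  obtain ⟨t, hs, hc⟩ := exists_sin_cos_eq (κ j)
  have hrank : ∀ x ∈ U, Module.finrank ℝ
      (LinearMap.range (fderiv ℝ (parallelMap t φ N) x).toLinearMap) = n - m j := fun x hx => by
    have := hchart.finrank_range_fderiv_parallelMap hx hs hc
    omega
  obtain ⟨π, ψ, hπ, hψ, hF⟩ := exists_factorization_of_finrank_range_eq (r := n - m j)
    (hchart.contDiffAt_parallelMap (t := t) hx₀)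
    (by filter_upwards [hchart.isOpen.mem_nhds hx₀] with x hx using hrank x hx)
  have hfac : IsFocalFactorization U φ N κ m j t x₀ π ψ :=
    ⟨hchart, hκ, hx₀, hs, hc, hπ, hψ, hF, by
      have := hchart.finrank_range_fderiv_parallelMap hx₀ hs hc
      omega⟩
  exact hfac.exists_focalCurvature_eq_neg hk

/-- A focal manifold of dimension less than `n` comes from one of the principal curvatures, and the
multiplicity of the latter is the codimension. -/
theorem exists_isFocalFactorization {κ : Fin 4 → ℝ} {m : Fin 4 → ℕ}
    (hM : IsSphereHypersurface n M) (hν : IsUnitNormalField n M ν)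
    (hiso : IsIsoparametric n M ν κ m) (hd : d < n) {t : ℝ} {V : Set (E d)}
    {ψ : E d → E (n + 2)} (hψ : IsLocalParam (parallelSet M ν t) V ψ) {y₀ : E d} (hy₀ : y₀ ∈ V) :
    ∃ (U : Set (E n)) (φ : E n → E (n + 2)) (x₀ : E n) (π : E n → E d) (j : Fin 4),
      IsLocalParam M U φ ∧ π x₀ = y₀ ∧ IsFocalFactorization U φ (ν ∘ φ) κ m j t x₀ π ψ := by
  obtain ⟨p, hp, hpy⟩ := hψ.mem hy₀
  obtain ⟨U, φ, hφ, x₀, hx₀, rfl⟩ := hM.submanifold p hp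
  have hchart := isPrincipalChart hM hν hiso hφ ⟨x₀, hx₀⟩
  have hF := hchart.contDiffAt_parallelMap (t := t) hx₀
  obtain ⟨π, hπ, hπ0, hfac⟩ := hψ.exists_lift hy₀ hF hpy (by
    filter_upwards [hφ.isOpen.mem_nhds hx₀] with x hx
    exact ⟨φ x, hφ.mem hx, rfl⟩)
  have hψ2 : ContDiffAt ℝ 2 ψ (π x₀) := by
    rw [hπ0]
    exact (hψ.smooth.contDiffAt (hψ.isOpen.mem_nhds hy₀)).of_le two_le_infty
  have hle : Module.finrank ℝ
      (LinearMap.range (fderiv ℝ (parallelMap t φ (ν ∘ φ)) x₀).toLinearMap) ≤ d := by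
    rw [hfac.fderiv_eq, fderiv_comp x₀ (hψ2.differentiableAt (by simp))
      (hπ.differentiableAt (by simp))]
    refine (Submodule.finrank_mono (LinearMap.range_comp_le_range
      (fderiv ℝ π x₀).toLinearMap (fderiv ℝ ψ (π x₀)).toLinearMap)).trans ?_
    simpa using LinearMap.finrank_range_le (fderiv ℝ ψ (π x₀)).toLinearMap
  -- As d < n the parallel map has a kernel vector; it is a principal direction with curvature cot
  -- t, which picks out `j`.
  obtain ⟨v, hv, hv0⟩ : ∃ v, fderiv ℝ (parallelMap t φ (ν ∘ φ)) x₀ v = 0 ∧ v ≠ 0 := by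
    by_contra! hcon
    have hinj : Function.Injective (fderiv ℝ (parallelMap t φ (ν ∘ φ)) x₀).toLinearMap := by
      rw [← LinearMap.ker_eq_bot, LinearMap.ker_eq_bot']
      exact hcon
    rw [LinearMap.finrank_range_of_inj hinj, finrank_euclideanSpace_fin] at hle
    omega
  rw [hchart.fderiv_parallelMap hx₀] at hv
  have hs : Real.sin t ≠ 0 := by
    intro hs
    have hc : Real.cos t ≠ 0 := fun hc => by
      have := Real.sin_sq_add_cos_sq t
      rw [hs, hc] at this
      norm_num at this
    rw [hs, zero_smul, add_zero, smul_eq_zero] at hv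
    exact hv0 (hφ.immersion x₀ hx₀ ((hv.resolve_left hc).trans (map_zero _).symm))
  obtain ⟨j, hj⟩ := hchart.eq_curvature x₀ hx₀ (Real.cos t / Real.sin t) v hv0 (by
    apply smul_right_injective _ hs
    simp only [smul_add, smul_smul, smul_zero]
    rw [mul_div_cancel₀ _ hs]
    exact (add_comm _ _).trans hv)
  have hc : Real.cos t = κ j * Real.sin t := by rw [← hj, div_mul_cancel₀ _ hs]
  refine ⟨U, φ, x₀, π, j, hφ, hπ0, hchart, hiso.distinct, hx₀, hs, hc, hπ, hψ2, hfac, ?_⟩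
  -- The rank n - m_j is at most d by the factorization; the converse needs the whole focal set,
  -- through its Hausdorff dimension.
  have h1 : (d : ENNReal) ≤ (n - m j : ℕ) :=
    (hψ.le_dimH hy₀).trans (dimH_parallelSet_le hM hν hiso hs hc)
  have h2 : d ≤ n - m j := by exact_mod_cast h1
  have h3 := hchart.finrank_range_fderiv_parallelMap hx₀ hs hc
  omega

end Main

end FocalAnalysis

end FocalRicci

end

theorem propositionP (n : ℕ)
    (M : Set (EuclideanSpace ℝ (Fin (n + 2))))
    (ν : EuclideanSpace ℝ (Fin (n + 2)) → EuclideanSpace ℝ (Fin (n + 2)))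
    (hM : FocalRicci.IsSphereHypersurface n M)
    (hν : FocalRicci.IsUnitNormalField n M ν)
    (κ : Fin 4 → ℝ) (m : Fin 4 → ℕ)
    (hiso : FocalRicci.IsIsoparametric n M ν κ m)
    (hmin : FocalRicci.IsMinimal n M ν)
    (m₁ m₂ : ℕ)
    (hm₁ : IsLeast (Set.range m) m₁) (hm₂ : IsGreatest (Set.range m) m₂)
    (Mplus : Set (EuclideanSpace ℝ (Fin (n + 2))))
    (hfocal : FocalRicci.IsFocalManifold n M ν (1 + m₁) Mplus)
    (hB : (3 * (m₁ : ℝ) + 10) / 4 < (m₂ : ℝ)) :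
    FocalRicci.HasPositiveRicci (n - m₁) Mplus := by
  obtain ⟨hm₁pos, ⟨t, rfl⟩, d, hd, -⟩ := hfocal
  obtain rfl : d = n - m₁ := by omega
  intro V ψ hψ y₀ hy₀ v hv
  obtain ⟨U, φ, x₀, π, j, hφ, rfl, hfac⟩ := FocalRicci.exists_isFocalFactorization hM hν hiso
    (by omega) hψ hy₀
  have hcube : ∀ k ≠ j, FocalRicci.focalCurvature κ j k ^ 3 = FocalRicci.focalCurvature κ j k :=
    fun k hk => FocalRicci.focalCurvature_pow_three hiso.distinct
      (fun i l hl => FocalRicci.exists_focalCurvature_eq_neg hfac.chart hiso.distinct hfac.mem hl) hk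
  have hnorm : ∀ y ∈ V, ‖ψ y‖ = 1 := by
    intro y hy
    obtain ⟨p, hp, hpy⟩ := hψ.mem hy
    obtain ⟨U', φ', hφ', x, hx, rfl⟩ := hM.submanifold p hp
    rw [← hpy]
    exact (FocalRicci.isPrincipalChart hM hν hiso hφ' ⟨x, hx⟩).norm_parallelMap hx
  refine FocalRicci.sum_ricci_pos hψ.isOpen hψ.smooth hψ.immersion hnorm hy₀
    (fun α hα hn => ⟨hfac.shape_pow_three hcube hα hn, hfac.shape_trace hcube hα hn⟩) ?_ hv
  rw [hfac.finrank_normalSpace]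
  have hsum := FocalRicci.sum_mult_le hiso hφ hfac.mem
  have hdim := hfac.dim_add
  have hlow : ∀ k, m₁ ≤ m k := fun k => hm₁.2 ⟨k, rfl⟩
  obtain ⟨k, rfl⟩ := hm₂.1
  -- With m₁ ≥ 1 the bound reads m₂ > 13/4. Then n - m₁ ≥ 2m₁ + m₂ > m₁ + 2.
  have hk : 4 ≤ m k := by
    have h1 : (1 : ℝ) ≤ m₁ := by exact_mod_cast (by omega : 1 ≤ m₁)
    have h2 : (3 : ℝ) < m k := by linarith
    exact_mod_cast h2
  rw [Fin.sum_univ_four] at hsum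
  have h0 := hlow 0
  have h1 := hlow 1
  have h2 := hlow 2
  have h3 := hlow 3
  fin_cases k <;> simp at hk <;> omega
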